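/- A skew morphism of a finite group $B$ is a permutation $\varphi$ of $B$ that fixes the identity and such that for every $a\in B$ there is a positive integer $i_a$ with $\varphi(ab)=\varphi(a)\varphi^{i_a}(b)$ for all $b\in B$. Let $\pi(a)$ denote the unique such $i_a$ in $\{1,\dots,\mathrm{ord}(\varphi)\}$, where $\mathrm{ord}(\varphi)$ is the order of the permutation $\varphi$. Call $\varphi$ proper if it is not an automorphism of $B$, and coset-preserving if $\pi(a)=\pi(\varphi(a))$ for all $a\in B$. Two skew morphisms $\varphi,\psi$ of $B$ are equivalent if $\psi=\alpha\varphi\alpha^{-1}$ for some $\alpha\in\mathrm{Aut}(B)$. Let $p$ be an odd prime, and let $\mathrm{C}_{4p}$ be the cyclic group of order $4p$. If $p\equiv 1\pmod 4$, then $\mathrm{C}_{4p}$ admits exactly $4p-4$ proper skew morphisms, which fall into exactly three equivalence classes. If $p\equiv 3\pmod 4$, then $\mathrm{C}_{4p}$ admits exactly $2p-2$ proper skew morphisms, which fall into exactly two equivalence classes. Moreover, in both cases all proper skew morphisms of $\mathrm{C}_{4p}$ are coset-preserving. -/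

import Mathlib

/-- A skew morphism of a group `B`: a permutation `φ` of `B` that fixes the identity and such that
for every `a` there is a positive integer `i` with `φ (a * b) = φ a * φ^i b` for all `b`. -/
structure IsSkewMorphism {B : Type*} [Group B] (φ : Equiv.Perm B) : Prop where
  map_one : φ 1 = 1
  exists_exponent : ∀ a : B, ∃ i : ℕ, 0 < i ∧ ∀ b : B, φ (a * b) = φ a * (φ ^ i) b

/-- The power function of `φ`: its value at `a` is the exponent `i ∈ {1, …, ord φ}` with
`φ (a * b) = φ a * φ^i b` for all `b`. For a skew morphism of a finite group there is exactly
one such exponent (`IsSkewMorphism.existsUnique_exponent`), so the infimum is that exponent. -/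
noncomputable def skewPower {B : Type*} [Group B] (φ : Equiv.Perm B) (a : B) : ℕ :=
  sInf {i : ℕ | 1 ≤ i ∧ i ≤ orderOf φ ∧ ∀ b : B, φ (a * b) = φ a * (φ ^ i) b}

theorem IsSkewMorphism.existsUnique_exponent {B : Type*} [Group B] [Finite B]
    {φ : Equiv.Perm B} (h : IsSkewMorphism φ) (a : B) :
    ∃! i : ℕ, 1 ≤ i ∧ i ≤ orderOf φ ∧ ∀ b : B, φ (a * b) = φ a * (φ ^ i) b := by
  have hpos : 0 < orderOf φ := orderOf_pos φ
  obtain ⟨i, -, hi⟩ := h.exists_exponent a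
  refine existsUnique_of_exists_of_unique ?_ ?_
  · by_cases h0 : i % orderOf φ = 0
    · refine ⟨orderOf φ, hpos, le_rfl, fun b => ?_⟩
      rw [hi b, ← pow_mod_orderOf φ i, h0, pow_zero, pow_orderOf_eq_one]
    · refine ⟨i % orderOf φ, Nat.one_le_iff_ne_zero.2 h0, (Nat.mod_lt _ hpos).le, fun b => ?_⟩
      rw [hi b, pow_mod_orderOf]
  · rintro j k ⟨hj1, hj2, hj⟩ ⟨hk1, hk2, hk⟩
    have hjk : φ ^ j = φ ^ k := by
      ext b
      exact mul_left_cancel ((hj b).symm.trans (hk b))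
    have hmod := pow_eq_pow_iff_modEq.1 hjk
    have hd : (orderOf φ : ℤ) ∣ (k : ℤ) - j := (Nat.modEq_iff_dvd).1 hmod
    have h0 : (k : ℤ) - j = 0 :=
      Int.eq_zero_of_abs_lt_dvd hd (abs_lt.2 ⟨by omega, by omega⟩)
    omega

theorem IsSkewMorphism.skewPower_spec {B : Type*} [Group B] [Finite B]
    {φ : Equiv.Perm B} (h : IsSkewMorphism φ) (a : B) :
    1 ≤ skewPower φ a ∧ skewPower φ a ≤ orderOf φ ∧
      ∀ b : B, φ (a * b) = φ a * (φ ^ skewPower φ a) b :=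
  Nat.sInf_mem (h.existsUnique_exponent a).exists

/-- A skew morphism is proper if it is not an automorphism of the group. -/
def IsProperSkewMorphism {B : Type*} [Group B] (φ : Equiv.Perm B) : Prop :=
  IsSkewMorphism φ ∧ ¬ ∃ α : MulAut B, ∀ b : B, φ b = α b

/-- `φ` is a coset-preserving skew morphism: its power function `π` satisfies
`π a = π (φ a)` for all `a`. -/
def IsCosetPreserving {B : Type*} [Group B] (φ : Equiv.Perm B) : Prop :=
  IsSkewMorphism φ ∧ ∀ a : B, skewPower φ a = skewPower φ (φ a)

/-- Two permutations of `B` are equivalent if they lie in the same orbit of `Sym B` under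
conjugation by automorphisms of `B`. -/
def SkewEquivalent {B : Type*} [Group B] (φ ψ : Equiv.Perm B) : Prop :=
  ∃ α : MulAut B, ψ = MulAut.toPerm B α * φ * (MulAut.toPerm B α)⁻¹

/-- Equivalence as an equivalence relation on the set of proper skew morphisms of `B`. -/
def properSkewSetoid (B : Type*) [Group B] :
    Setoid {φ : Equiv.Perm B // IsProperSkewMorphism φ} where
  r φ ψ := SkewEquivalent φ.1 ψ.1
  iseqv :=
    { refl := fun φ => ⟨1, by simp⟩
      symm := by
        rintro φ ψ ⟨α, h⟩
        exact ⟨α⁻¹, by rw [h, map_inv]; group⟩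
      trans := by
        rintro φ ψ χ ⟨α, h⟩ ⟨β, k⟩
        exact ⟨β * α, by rw [k, h, map_mul]; group⟩ }

/-!
Let `φ` be a skew morphism of a cyclic group `B` of order `4 p`, and let `K` be its kernel, the
subgroup on which the power function is `1`. It is `φ`-invariant, the power function separates its
cosets, and `φ` induces a skew morphism on `B ⧸ K`.

The first step is that the subgroup of order `p` lies in `K`. The order of `φ` is the length of
the orbit of a generator (`IsSkewMorphism.orderOf_eq_minimalPeriod`), hence less than the order of
`B`, and so `K` is nontrivial. Comparing this orbit with its image in `B ⧸ K`, and the exponents of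
`φ` with those of the induced skew morphism, shows that the kernel of the latter is no larger than
`K` (`IsSkewMorphism.card_skewKernel_quotientPerm_le`). Passing to successive quotients one finds
that `K` cannot have order `2`, and has order `4` only if `p = 3`, where a finite check shows that
`K` is nevertheless everything (`IsSkewMorphism.dvd_card_skewKernel`, `add_right_of_add_left`).

Consequently, on `ZMod 4 × ZMod p`, `φ` is an affine map `(i, y) ↦ (g i, c i + r y)` with `g`
a skew morphism of `ZMod 4`, that is, `g = ± id`. The skew identity is then a system of equations
for `c` over the field `ZMod p` (`affineMap_id_skew`, `affineMap_neg_skew`). Apart from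
automorphisms it leaves `r = 1` and
* `g = id` and `c i = u (1 + l + ⋯ + l ^ (i - 1))` with `l ^ 4 = 1`, `l ≠ 1`, `u ≠ 0`, or
* `g = -id` and `c i = u` for odd `i`, `c i = 0` for even `i`, `u ≠ 0`.

So there are `p - 1` proper skew morphisms for each nontrivial fourth root of unity `l` and `p - 1`
further ones. Automorphisms of `ZMod p` permute the `u` transitively, inversion of `ZMod 4` replaces
`l` by `l⁻¹`, and `l ^ 2` is an invariant (`standardSkew_equivalent_iff`). Coset preservation is
read off from the formulas (`standardSkew_translate`).
-/

/-! ### The kernel of a skew morphism -/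

/-- The kernel of a permutation `φ` fixing the identity: the elements `a` with
`φ (a * b) = φ a * φ b` for all `b`. For a skew morphism these are the elements at which the
power function takes the value `1`. -/
def skewKernel {B : Type*} [Group B] (φ : Equiv.Perm B) (h1 : φ 1 = 1) : Subgroup B where
  carrier := {a | ∀ b, φ (a * b) = φ a * φ b}
  one_mem' b := by simp [h1]
  mul_mem' {a c} ha hc b := by
    rw [mul_assoc, ha, hc, ha, mul_assoc]
  inv_mem' {a} ha := by
    have key (b : B) : φ (a⁻¹ * b) = (φ a)⁻¹ * φ b := by
      rw [eq_inv_mul_iff_mul_eq, ← ha, mul_inv_cancel_left]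
    intro b
    have h := key 1
    rw [mul_one, h1, mul_one] at h
    rw [key, h]

namespace IsSkewMorphism

variable {B : Type*} [CommGroup B] {φ : Equiv.Perm B}

/-- The kernel of a skew morphism of an abelian group is invariant under the skew morphism. -/
theorem map_mem_skewKernel (h : IsSkewMorphism φ) {a : B} (ha : a ∈ skewKernel φ h.map_one) :
    φ a ∈ skewKernel φ h.map_one := by
  intro b
  obtain ⟨i, -, hi⟩ := h.exists_exponent b
  have h1 : (φ ^ i) a = φ a := by
    have := hi a
    rw [mul_comm b a, ha b, mul_comm] at this
    exact (mul_left_cancel this).symm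
  have h2 : (φ ^ i) (φ a) = φ (φ a) := by
    rw [← Equiv.Perm.mul_apply, (Commute.self_pow φ i).symm.eq, Equiv.Perm.mul_apply, h1]
  rw [mul_comm, hi, h2, mul_comm]

/-- Two elements with the same exponent lie in the same coset of the kernel. -/
theorem inv_mul_mem_skewKernel (h : IsSkewMorphism φ) {a c : B} {i : ℕ}
    (ha : ∀ b, φ (a * b) = φ a * (φ ^ i) b) (hc : ∀ b, φ (c * b) = φ c * (φ ^ i) b) :
    a⁻¹ * c ∈ skewKernel φ h.map_one := by
  have key (b : B) : φ (a⁻¹ * c * b) = (φ a)⁻¹ * φ c * φ b := by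
    have h1 := hc (a⁻¹ * b)
    have h2 := ha (a⁻¹ * b)
    rw [mul_inv_cancel_left] at h2
    rw [h2, show a⁻¹ * c * b = c * (a⁻¹ * b) by rw [mul_comm a⁻¹ c, mul_assoc], h1]
    rw [mul_comm (φ a)⁻¹, mul_assoc, inv_mul_cancel_left]
  intro b
  have h1 := key 1
  rw [mul_one, h.map_one, mul_one] at h1
  rw [key, h1]

/-- Elements of the same coset of the kernel have the same exponents. -/
theorem exponent_of_inv_mul_mem (h : IsSkewMorphism φ) {a c : B} {i : ℕ}
    (hac : a⁻¹ * c ∈ skewKernel φ h.map_one)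
    (ha : ∀ b, φ (a * b) = φ a * (φ ^ i) b) (b : B) : φ (c * b) = φ c * (φ ^ i) b := by
  have hc : c = a⁻¹ * c * a := by rw [mul_comm, mul_inv_cancel_left]
  rw [hc, mul_assoc, hac, ha, hac, mul_assoc]

/-- Powers of a skew morphism satisfy the same kind of identity. -/
theorem exists_pow_mul (h : IsSkewMorphism φ) (n : ℕ) (a : B) :
    ∃ s : ℕ, ∀ b, (φ ^ n) (a * b) = (φ ^ n) a * (φ ^ s) b := by
  induction n with
  | zero => exact ⟨0, by simp⟩
  | succ n ih =>
    obtain ⟨s, hs⟩ := ih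
    obtain ⟨i, -, hi⟩ := h.exists_exponent ((φ ^ n) a)
    refine ⟨i + s, fun b => ?_⟩
    simp only [pow_succ', Equiv.Perm.mul_apply, hs, hi, pow_add]

/-- The order of a skew morphism of a cyclic group is the length `t` of the orbit of a generator
`g`. Indeed `φ ^ t (g * b) = g * φ ^ s b` for some `s`, so `φ ^ s` is conjugate to `φ ^ t`; by
comparison of orders `φ ^ s` is a power of `φ ^ t`, and it follows by induction on `n` that the
powers of `φ ^ t` fix all `g ^ n`. -/
theorem orderOf_eq_minimalPeriod [Finite B] (h : IsSkewMorphism φ) {g : B}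
    (hg : ∀ x, x ∈ Submonoid.powers g) : orderOf φ = Function.minimalPeriod φ g := by
  set t := Function.minimalPeriod φ g with ht
  have htg : (φ ^ t) g = g := by
    rw [← Equiv.Perm.iterate_eq_pow]
    exact Function.isPeriodicPt_minimalPeriod φ g
  have htm : t ∣ orderOf φ := by
    apply Function.IsPeriodicPt.minimalPeriod_dvd
    rw [Function.IsPeriodicPt, Equiv.Perm.iterate_eq_pow, pow_orderOf_eq_one]
    rfl
  have hm : 0 < orderOf φ := orderOf_pos φ
  have htpos : 0 < t := Nat.pos_of_dvd_of_pos htm hm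
  obtain ⟨s, hs⟩ := h.exists_pow_mul t g
  rw [htg] at hs
  have hconj : φ ^ t = Equiv.mulLeft g * φ ^ s * (Equiv.mulLeft g)⁻¹ := by
    rw [eq_mul_inv_iff_mul_eq]
    ext b
    simp [hs]
  have hord : orderOf (φ ^ t) = orderOf (φ ^ s) := by
    rw [hconj]
    exact orderOf_injective (MulAut.conj (Equiv.mulLeft g)).toMonoidHom
      (MulAut.conj (Equiv.mulLeft g)).injective (φ ^ s)
  have hts : t ∣ s := by
    rw [orderOf_pow, orderOf_pow, Nat.gcd_eq_right htm] at hord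
    have h1 := Nat.div_mul_cancel htm
    have h2 := Nat.div_mul_cancel (Nat.gcd_dvd_left (orderOf φ) s)
    rw [← hord] at h2
    have h3 : (orderOf φ).gcd s = t :=
      Nat.eq_of_mul_eq_mul_left (Nat.div_pos (Nat.le_of_dvd hm htm) htpos) (h2.trans h1.symm)
    exact h3 ▸ Nat.gcd_dvd_right _ _
  obtain ⟨k, rfl⟩ := hts
  have key : ∀ n j : ℕ, ((φ ^ t) ^ j) (g ^ n) = g ^ n := by
    intro n
    induction n with
    | zero =>
      intro j
      rw [pow_zero, ← pow_mul]
      exact Function.IsFixedPt.perm_pow h.map_one _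
    | succ n ih =>
      have step (b : B) : (φ ^ t) (g * b) = g * ((φ ^ t) ^ k) b := by rw [hs, pow_mul]
      have steps (j : ℕ) (b : B) : ((φ ^ t) ^ j) (g * b) = g * ((φ ^ t) ^ (k * j)) b := by
        induction j with
        | zero => simp
        | succ j ihj =>
          rw [pow_succ', Equiv.Perm.mul_apply, ihj, step, ← Equiv.Perm.mul_apply, ← pow_add,
            mul_add, mul_one, add_comm]
      intro j
      rw [pow_succ', steps, ih]
  refine Nat.dvd_antisymm (orderOf_dvd_of_pow_eq_one ?_) htm
  ext x
  obtain ⟨n, rfl⟩ := hg x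
  simpa using key n 1

/-- The order of a skew morphism of a cyclic group is at most the size of any invariant set
containing a generator. -/
theorem orderOf_le_ncard [Finite B] (h : IsSkewMorphism φ) {g : B}
    (hg : ∀ x, x ∈ Submonoid.powers g) {S : Set B} (hgS : g ∈ S) (hS : ∀ x ∈ S, φ x ∈ S) :
    orderOf φ ≤ S.ncard := by
  rw [h.orderOf_eq_minimalPeriod hg]
  have hmem (n : ℕ) : φ^[n] g ∈ S := by
    induction n with
    | zero => exact hgS
    | succ n ih => rw [Function.iterate_succ_apply']; exact hS _ ih
  have hinj : Set.InjOn (fun n => φ^[n] g) (Set.Iio (Function.minimalPeriod φ g)) :=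
    Function.iterate_injOn_Iio_minimalPeriod
  calc Function.minimalPeriod φ g
      = (Set.Iio (Function.minimalPeriod φ g)).ncard := by simp
    _ ≤ S.ncard := Set.ncard_le_ncard_of_injOn _ (fun n _ => hmem n) hinj (Set.toFinite S)

theorem orderOf_lt_card [Finite B] [IsCyclic B] [Nontrivial B] (h : IsSkewMorphism φ) :
    orderOf φ < Nat.card B := by
  obtain ⟨g, hg⟩ := IsCyclic.exists_monoid_generator (α := B)
  have hg1 : g ≠ 1 := by
    rintro rfl
    obtain ⟨x, hx⟩ := exists_ne (1 : B)
    obtain ⟨n, hn⟩ := hg x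
    exact hx (by simpa using hn.symm)
  refine (h.orderOf_le_ncard hg (S := {1}ᶜ) hg1 fun x hx h1 => hx ?_).trans_lt ?_
  · exact φ.injective (h1.trans h.map_one.symm)
  · rw [← Set.ncard_add_ncard_compl ({1} : Set B), Set.ncard_singleton]
    omega

/-- The cosets of the kernel correspond to distinct exponents in `{1, …, orderOf φ}`. -/
theorem index_skewKernel_le [Finite B] (h : IsSkewMorphism φ) :
    (skewKernel φ h.map_one).index ≤ orderOf φ := by
  have hex (x : B ⧸ skewKernel φ h.map_one) := (h.existsUnique_exponent x.out).exists
  choose e he1 he2 he using hex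
  have hinj : Function.Injective fun x => (⟨e x - 1, by
      have := he1 x; have := he2 x; omega⟩ : Fin (orderOf φ)) := by
    intro x y hxy
    have hxy : e x = e y := by
      have := he1 x; have := he1 y
      have := congrArg Fin.val hxy
      simp only at this
      omega
    rw [← x.out_eq', ← y.out_eq', QuotientGroup.eq]
    exact h.inv_mul_mem_skewKernel (he x) (by rw [hxy]; exact he y)
  simpa [Subgroup.index] using Nat.card_le_card_of_injective _ hinj

/-- The kernel of a skew morphism of a nontrivial cyclic group is nontrivial. -/
theorem one_lt_card_skewKernel [Finite B] [IsCyclic B] [Nontrivial B] (h : IsSkewMorphism φ) :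
    1 < Nat.card (skewKernel φ h.map_one) := by
  by_contra hle
  have h1 := (skewKernel φ h.map_one).card_mul_index
  have h2 := h.index_skewKernel_le
  have h3 := h.orderOf_lt_card
  have h4 := Nat.mul_le_mul_right (skewKernel φ h.map_one).index (not_lt.1 hle)
  omega

/-! ### The induced skew morphism on the quotient by the kernel -/

theorem map_mul_of_mem (h : IsSkewMorphism φ) {a : B} (ha : a ∈ skewKernel φ h.map_one) (b : B) :
    φ (a * b) = φ a * φ b := ha b

/-- The permutation of the quotient by the kernel induced by a skew morphism. -/
noncomputable def quotientPerm [Finite B] (h : IsSkewMorphism φ) :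
    Equiv.Perm (B ⧸ skewKernel φ h.map_one) :=
  Equiv.ofBijective
    (Quotient.map' φ fun a b hab => by
      rw [QuotientGroup.leftRel_apply] at hab ⊢
      have hb : φ b = φ (a⁻¹ * b) * φ a := by
        rw [← h.map_mul_of_mem hab, mul_comm, mul_inv_cancel_left]
      rw [hb, mul_comm (φ (a⁻¹ * b)), inv_mul_cancel_left]
      exact h.map_mem_skewKernel hab)
    (Finite.surjective_iff_bijective.1 <| by
      intro y
      induction y using QuotientGroup.induction_on with
      | H b => exact ⟨(φ.symm b : B), by
          change ((φ (φ.symm b) : B) : B ⧸ skewKernel φ h.map_one) = b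
          rw [Equiv.apply_symm_apply]⟩)

@[simp]
theorem quotientPerm_mk [Finite B] (h : IsSkewMorphism φ) (a : B) :
    h.quotientPerm (a : B ⧸ skewKernel φ h.map_one) = (φ a : B) := rfl

theorem quotientPerm_pow_mk [Finite B] (h : IsSkewMorphism φ) (n : ℕ) (a : B) :
    (h.quotientPerm ^ n) (a : B ⧸ skewKernel φ h.map_one) = ((φ ^ n) a : B) := by
  induction n with
  | zero => rfl
  | succ n ih => rw [pow_succ', Equiv.Perm.mul_apply, ih, quotientPerm_mk, pow_succ',
      Equiv.Perm.mul_apply]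

theorem quotientPerm_exponent [Finite B] (h : IsSkewMorphism φ) {a : B} {i : ℕ}
    (ha : ∀ b, φ (a * b) = φ a * (φ ^ i) b) (y : B ⧸ skewKernel φ h.map_one) :
    h.quotientPerm (a * y) = h.quotientPerm a * (h.quotientPerm ^ i) y := by
  induction y using QuotientGroup.induction_on with
  | H b => rw [← QuotientGroup.mk_mul, quotientPerm_mk, ha, quotientPerm_pow_mk]; rfl

theorem quotientPerm_isSkewMorphism [Finite B] (h : IsSkewMorphism φ) :
    IsSkewMorphism h.quotientPerm where
  map_one := by rw [← QuotientGroup.mk_one, quotientPerm_mk, h.map_one]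
  exists_exponent x := by
    induction x using QuotientGroup.induction_on with
    | H a =>
      obtain ⟨i, hi, ha⟩ := h.exists_exponent a
      exact ⟨i, hi, h.quotientPerm_exponent ha⟩

/-- The orbit of a generator lies over the orbit of its image in the quotient. -/
theorem orderOf_le_mul [Finite B] [IsCyclic B] (h : IsSkewMorphism φ) :
    orderOf φ ≤ Nat.card (skewKernel φ h.map_one) * orderOf h.quotientPerm := by
  obtain ⟨g, hg⟩ := IsCyclic.exists_monoid_generator (α := B)
  set K := skewKernel φ h.map_one
  let O : Set (B ⧸ K) := (fun i : ℕ => (h.quotientPerm ^ i) (g : B ⧸ K)) ''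
    Set.Iio (orderOf h.quotientPerm)
  have hO : O.ncard ≤ orderOf h.quotientPerm := by
    simpa using Set.ncard_image_le (f := fun i : ℕ => (h.quotientPerm ^ i) (g : B ⧸ K))
      (Set.finite_Iio (orderOf h.quotientPerm))
  have hpos : 0 < orderOf h.quotientPerm := orderOf_pos _
  refine (h.orderOf_le_ncard hg (S := QuotientGroup.mk ⁻¹' O) ⟨0, hpos, rfl⟩ ?_).trans ?_
  · rintro x ⟨i, -, hi⟩
    refine ⟨(i + 1) % orderOf h.quotientPerm, Nat.mod_lt _ hpos, ?_⟩
    simp only [pow_mod_orderOf, pow_succ', Equiv.Perm.mul_apply] at hi ⊢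
    rw [hi, quotientPerm_mk]
  · rw [← Nat.card_coe_set_eq, QuotientGroup.card_preimage_mk, Nat.card_coe_set_eq]
    exact Nat.mul_le_mul_left _ hO

/-- The kernel of the induced skew morphism is no larger than the kernel of `φ`.
The exponents of `φ` are determined modulo the order of the induced skew morphism by the
image in the quotient by the second kernel, and `orderOf φ` is at most the order of the kernel
times that order. So the order of the kernel bounds the order of the second kernel. -/
theorem card_skewKernel_quotientPerm_le [Finite B] [IsCyclic B] (h : IsSkewMorphism φ) :
    Nat.card (skewKernel h.quotientPerm h.quotientPerm_isSkewMorphism.map_one) ≤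
      Nat.card (skewKernel φ h.map_one) := by
  have h' := h.quotientPerm_isSkewMorphism
  set m := orderOf h.quotientPerm with hm
  have hpos : 0 < m := orderOf_pos _
  have hex (x : B ⧸ skewKernel φ h.map_one) := (h.existsUnique_exponent x.out).exists
  choose e he1 he2 he using hex
  have hlt (x) : (e x - 1) / m < Nat.card (skewKernel φ h.map_one) := by
    rw [Nat.div_lt_iff_lt_mul hpos]
    have := h.orderOf_le_mul
    rw [← hm] at this
    have := he1 x; have := he2 x
    omega
  have heq (x y) (hxy : x⁻¹ * y ∈ skewKernel h.quotientPerm h'.map_one) :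
      e x ≡ e y [MOD m] := by
    rw [← pow_eq_pow_iff_modEq]
    ext b
    have hx := h.quotientPerm_exponent (he x)
    have hy := h.quotientPerm_exponent (he y)
    rw [QuotientGroup.out_eq'] at hx hy
    exact mul_left_cancel ((h'.exponent_of_inv_mul_mem hxy hx b).symm.trans (hy b))
  have hinj : Function.Injective fun x : B ⧸ skewKernel φ h.map_one =>
      ((x : (B ⧸ skewKernel φ h.map_one) ⧸ skewKernel h.quotientPerm h'.map_one),
        (⟨(e x - 1) / m, hlt x⟩ : Fin (Nat.card (skewKernel φ h.map_one)))) := by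
    intro x y hxy
    simp only [Prod.mk.injEq, Fin.mk.injEq] at hxy
    obtain ⟨h1, h2⟩ := hxy
    have h3 := heq x y (QuotientGroup.eq.1 h1)
    have h4 : e x = e y := by
      have hx := he1 x; have hy := he1 y
      have h5 : (e x - 1) % m = (e y - 1) % m :=
        Nat.ModEq.add_right_cancel' 1 (by rwa [Nat.sub_add_cancel hx, Nat.sub_add_cancel hy])
      have h6 := Nat.div_add_mod (e x - 1) m
      have h7 := Nat.div_add_mod (e y - 1) m
      rw [h2, h5, h7] at h6
      omega
    rw [← x.out_eq', ← y.out_eq', QuotientGroup.eq]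
    exact h.inv_mul_mem_skewKernel (he x) (by rw [h4]; exact he y)
  have hcard := Nat.card_le_card_of_injective _ hinj
  rw [Nat.card_prod, Nat.card_eq_fintype_card (α := Fin _), Fintype.card_fin,
    Subgroup.card_eq_card_quotient_mul_card_subgroup
      (skewKernel h.quotientPerm h'.map_one)] at hcard
  exact Nat.le_of_mul_le_mul_left hcard Nat.card_pos

/-! ### The kernel in cyclic groups of order `4 p` -/

/-- A skew morphism of a cyclic group of order `2 p`, `p` an odd prime, has no kernel of order
two: the quotient has prime order `p`, so the second kernel, being nontrivial, would be all of it
and thus larger than the first. -/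
theorem card_skewKernel_ne_two [Finite B] [IsCyclic B] (h : IsSkewMorphism φ) {p : ℕ}
    (hp : p.Prime) (hodd : Odd p) (hB : Nat.card B = 2 * p) :
    Nat.card (skewKernel φ h.map_one) ≠ 2 := by
  intro h2
  have h' := h.quotientPerm_isSkewMorphism
  have hq : Nat.card (B ⧸ skewKernel φ h.map_one) = p := by
    have := Subgroup.card_eq_card_quotient_mul_card_subgroup (skewKernel φ h.map_one)
    rw [hB, h2] at this
    omega
  have : Nontrivial (B ⧸ skewKernel φ h.map_one) :=
    Finite.one_lt_card_iff_nontrivial.1 (hq ▸ hp.one_lt)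
  have h1 := h'.one_lt_card_skewKernel
  have hle := h.card_skewKernel_quotientPerm_le
  have hdvd := Subgroup.card_subgroup_dvd_card (skewKernel h.quotientPerm h'.map_one)
  rw [hq, Nat.dvd_prime hp] at hdvd
  have := hp.two_le
  obtain ⟨k, rfl⟩ := hodd
  omega

/-- The kernel has order greater than `1`, and the second kernel is no larger. This rules out
order `2`, and order `4` unless `p ≤ 4`. -/
theorem dvd_card_skewKernel [Finite B] [IsCyclic B] (h : IsSkewMorphism φ) {p : ℕ}
    (hp : p.Prime) (hodd : Odd p) (hB : Nat.card B = 4 * p) :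
    p ∣ Nat.card (skewKernel φ h.map_one) ∨ p = 3 ∧ 4 ∣ Nat.card (skewKernel φ h.map_one) := by
  have hp2 := hp.two_le
  have h' := h.quotientPerm_isSkewMorphism
  have hB1 : Nontrivial B := Finite.one_lt_card_iff_nontrivial.1 (by omega)
  have hK1 := h.one_lt_card_skewKernel
  have hmul := Subgroup.card_eq_card_quotient_mul_card_subgroup (skewKernel φ h.map_one)
  have hle := h.card_skewKernel_quotientPerm_le
  rw [or_iff_not_imp_left]
  intro hndvd
  have hcop : Nat.Coprime (Nat.card (skewKernel φ h.map_one)) p :=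
    ((Nat.Prime.coprime_iff_not_dvd hp).2 hndvd).symm
  have hdvd4 : Nat.card (skewKernel φ h.map_one) ∣ 4 :=
    hcop.dvd_of_dvd_mul_right (hB ▸ Subgroup.card_subgroup_dvd_card _)
  have hcases : Nat.card (skewKernel φ h.map_one) = 2 ∨
      Nat.card (skewKernel φ h.map_one) = 4 := by
    have := Nat.le_of_dvd (by norm_num) hdvd4
    generalize Nat.card (skewKernel φ h.map_one) = k at *
    interval_cases k <;> simp_all
  rcases hcases with h2 | h4
  · have hq : Nat.card (B ⧸ skewKernel φ h.map_one) = 2 * p := by rw [hB, h2] at hmul; omega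
    have : Nontrivial (B ⧸ skewKernel φ h.map_one) :=
      Finite.one_lt_card_iff_nontrivial.1 (by omega)
    have h1 := h'.one_lt_card_skewKernel
    exact absurd (by omega) (h'.card_skewKernel_ne_two hp hodd hq)
  · have hq : Nat.card (B ⧸ skewKernel φ h.map_one) = p := by rw [hB, h4] at hmul; omega
    have : Nontrivial (B ⧸ skewKernel φ h.map_one) :=
      Finite.one_lt_card_iff_nontrivial.1 (by omega)
    have h1 := h'.one_lt_card_skewKernel
    have hdvd := Subgroup.card_subgroup_dvd_card (skewKernel h.quotientPerm h'.map_one)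
    rw [hq, Nat.dvd_prime hp] at hdvd
    refine ⟨?_, h4 ▸ dvd_rfl⟩
    obtain ⟨k, rfl⟩ := hodd
    omega

end IsSkewMorphism

/-- A subgroup of a cyclic group whose order is divisible by `d` contains every element killed
by `d`. -/
theorem Subgroup.mem_of_pow_eq_one_of_dvd_card {B : Type*} [Group B] [Finite B] [IsCyclic B]
    (K : Subgroup B) {d : ℕ} (hd : d ∣ Nat.card K) {x : B} (hx : x ^ d = 1) : x ∈ K := by
  classical
  have := Fintype.ofFinite B
  have hsub : (K : Set B).toFinset ⊆
      Finset.univ.filter fun a : B => a ^ Nat.card K = 1 := by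
    intro a ha
    simp only [Set.mem_toFinset, SetLike.mem_coe, Finset.mem_filter, Finset.mem_univ,
      true_and] at ha ⊢
    exact congrArg Subtype.val (pow_card_eq_one' (x := (⟨a, ha⟩ : K)))
  have heq := Finset.eq_of_subset_of_card_le hsub (by
    refine (IsCyclic.card_pow_eq_one_le Nat.card_pos).trans ?_
    rw [Set.toFinset_card, ← Nat.card_eq_fintype_card]; rfl)
  have hmem : x ∈ Finset.univ.filter fun a : B => a ^ Nat.card K = 1 := by
    obtain ⟨c, hc⟩ := hd
    rw [Finset.mem_filter, hc, pow_mul, hx, one_pow]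
    exact ⟨Finset.mem_univ x, rfl⟩
  rw [← heq] at hmem
  simpa using hmem

/-! ### Affine maps of `ZMod 4 × ZMod p` -/

theorem two_ne_zero_of_odd {p : ℕ} [Fact p.Prime] (hodd : Odd p) : (2 : ZMod p) ≠ 0 := by
  have h2 : ((2 : ℕ) : ZMod p) ≠ 0 := by
    rw [Ne, ZMod.natCast_eq_zero_iff, Nat.prime_dvd_prime_iff_eq Fact.out Nat.prime_two]
    rintro rfl
    exact absurd hodd (by decide)
  exact_mod_cast h2

/-- The map `(i, y) ↦ (g i, c i + r y)` of `ZMod 4 × ZMod p`. -/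
def affineMap {p : ℕ} (g : ZMod 4 → ZMod 4) (c : ZMod 4 → ZMod p) (r : ZMod p) :
    ZMod 4 × ZMod p → ZMod 4 × ZMod p :=
  fun x => (g x.1, c x.1 + r * x.2)

theorem affineMap_id_one_iterate {p : ℕ} (c : ZMod 4 → ZMod p) (n : ℕ) (x : ZMod 4 × ZMod p) :
    (affineMap id c 1)^[n] x = (x.1, n * c x.1 + x.2) := by
  induction n with
  | zero => simp
  | succ n ih =>
    rw [Function.iterate_succ_apply', ih]
    ext
    · rfl
    · simp only [affineMap]
      push_cast
      ring

theorem affineMap_id_iterate {p : ℕ} (c : ZMod 4 → ZMod p) (r : ZMod p) (n : ℕ)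
    (x : ZMod 4 × ZMod p) :
    ((affineMap id c r)^[n] x).1 = x.1 ∧
      (r - 1) * ((affineMap id c r)^[n] x).2 = (r ^ n - 1) * c x.1 + r ^ n * (r - 1) * x.2 := by
  induction n with
  | zero => simp
  | succ n ih =>
    rw [Function.iterate_succ_apply']
    simp only [affineMap] at ih ⊢
    refine ⟨ih.1, ?_⟩
    rw [ih.1]
    linear_combination r * ih.2

theorem affineMap_neg_one_iterate {p : ℕ} (c : ZMod 4 → ZMod p) (n : ℕ)
    (x : ZMod 4 × ZMod p) :
    (affineMap Neg.neg c 1)^[2 * n] x = (x.1, n * (c (-x.1) + c x.1) + x.2) := by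
  induction n with
  | zero => simp
  | succ n ih =>
    rw [mul_add, mul_one, add_comm (2 * n), Function.iterate_add_apply, ih]
    ext
    · simp [affineMap]
    · simp only [affineMap, Function.iterate_succ, Function.iterate_zero, Function.comp_apply, id]
      push_cast
      ring

theorem affineMap_neg_neg_one_iterate {p : ℕ} (c : ZMod 4 → ZMod p) (n : ℕ)
    (x : ZMod 4 × ZMod p) :
    (affineMap Neg.neg c (-1))^[2 * n] x = (x.1, n * (c (-x.1) - c x.1) + x.2) := by
  induction n with
  | zero => simp
  | succ n ih =>
    rw [mul_add, mul_one, add_comm (2 * n), Function.iterate_add_apply, ih]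
    ext
    · simp [affineMap]
    · simp only [affineMap, Function.iterate_succ, Function.iterate_zero, Function.comp_apply, id]
      push_cast
      ring

theorem affineMap_neg_iterate {p : ℕ} (c : ZMod 4 → ZMod p) (r : ZMod p) (n : ℕ)
    (x : ZMod 4 × ZMod p) :
    ((affineMap Neg.neg c r)^[2 * n] x).1 = x.1 ∧
      (r ^ 2 - 1) * ((affineMap Neg.neg c r)^[2 * n] x).2 =
        (r ^ (2 * n) - 1) * (c (-x.1) + r * c x.1) + r ^ (2 * n) * (r ^ 2 - 1) * x.2 := by
  induction n with
  | zero => simp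
  | succ n ih =>
    rw [mul_add, mul_one, add_comm (2 * n), Function.iterate_add_apply]
    simp only [affineMap, Function.iterate_succ, Function.iterate_zero, Function.comp_apply, id]
      at ih ⊢
    refine ⟨by rw [neg_neg, ih.1], ?_⟩
    rw [ih.1]
    linear_combination r ^ 2 * ih.2

/-- An affine map over the identity of `ZMod 4` satisfying the skew identity is additive, unless
`r = 1` and `c` is the nonzero crossed homomorphism `i ↦ c 1 * (1 + l + ⋯ + l ^ (i - 1))`. If `r ≠ 1`, the exponents `e` satisfy
`r ^ e = r`, and then the `e`-th iterate is the map itself. -/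
theorem affineMap_id_skew {p : ℕ} [Fact p.Prime] {c : ZMod 4 → ZMod p} {r : ZMod p}
    (hc : c 0 = 0)
    (h : ∀ i, ∃ e : ℕ, ∀ x, affineMap id c r ((i, 0) + x) =
      affineMap id c r (i, 0) + (affineMap id c r)^[e] x) :
    (∀ i x, affineMap id c r ((i, 0) + x) = affineMap id c r (i, 0) + affineMap id c r x) ∨
    (r = 1 ∧ c 1 ≠ 0 ∧ ∃ l : ZMod p, (1 + l) * (1 + l ^ 2) = 0 ∧ c 2 = c 1 * (1 + l) ∧
      c 3 = c 1 * (1 + l + l ^ 2)) := by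
  rcases eq_or_ne r 1 with rfl | hr
  · obtain ⟨e, he⟩ := h 1
    simp only [affineMap_id_one_iterate] at he
    have h1 := congrArg Prod.snd (he (1, 0))
    have h2 := congrArg Prod.snd (he (2, 0))
    have h3 := congrArg Prod.snd (he (3, 0))
    simp only [affineMap, Prod.mk_add_mk, show (1 : ZMod 4) + 1 = 2 from rfl,
      show (1 : ZMod 4) + 2 = 3 from rfl, show (1 : ZMod 4) + 3 = 0 from rfl, hc, add_zero,
      mul_zero] at h1 h2 h3
    rcases eq_or_ne (c 1) 0 with h0 | h0
    · left
      have hc2 : c 2 = 0 := by rw [h1, h0]; ring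
      have hc3 : c 3 = 0 := by rw [h2, hc2, h0]; ring
      have hall : ∀ i, c i = 0 := by
        intro i
        fin_cases i
        exacts [hc, h0, hc2, hc3]
      intro i x
      simp [affineMap, hall, Prod.ext_iff]
    · right
      refine ⟨rfl, h0, e, ?_, ?_, ?_⟩
      · apply mul_left_cancel₀ h0
        linear_combination -h3 - e * h2 - e ^ 2 * h1
      · linear_combination h1
      · linear_combination h2 + e * h1
  · left
    have hr' : r - 1 ≠ 0 := sub_ne_zero.2 hr
    intro i x
    obtain ⟨e, he⟩ := h i
    have hre : r ^ e = r := by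
      have h1 := congrArg Prod.snd (he (0, 1))
      have h2 := (affineMap_id_iterate c r e (0, 1)).2
      simp only [affineMap, Prod.mk_add_mk, Prod.snd_add, add_zero, zero_add, mul_zero,
        mul_one, id, hc] at h1 h2
      rw [← add_left_cancel h1] at h2
      apply mul_left_cancel₀ hr'
      linear_combination -h2
    rw [he]
    congr 1
    obtain ⟨h1, h2⟩ := affineMap_id_iterate c r e x
    ext
    · exact h1
    · apply mul_left_cancel₀ hr'
      rw [h2, hre]
      simp only [affineMap]
      ring

/-- An affine map over the inversion of `ZMod 4` satisfying the skew identity is additive,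
unless `r = 1` and `c` vanishes at even arguments and takes one nonzero value at odd ones.
If `r ≠ 1`, then for every exponent `e` the `e - 1`-st iterate is the identity. -/
theorem affineMap_neg_skew {p : ℕ} [Fact p.Prime] (hodd : Odd p) {c : ZMod 4 → ZMod p}
    {r : ZMod p} (hc : c 0 = 0) (hr0 : r ≠ 0)
    (h : ∀ i, ∃ e : ℕ, ∀ x, affineMap Neg.neg c r ((i, 0) + x) =
      affineMap Neg.neg c r (i, 0) + (affineMap Neg.neg c r)^[e] x) :
    (∀ i x, affineMap Neg.neg c r ((i, 0) + x) =
      affineMap Neg.neg c r (i, 0) + affineMap Neg.neg c r x) ∨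
    (r = 1 ∧ c 1 ≠ 0 ∧ c 2 = 0 ∧ c 3 = c 1) := by
  have h20 := two_ne_zero_of_odd hodd
  -- The exponents are odd, by comparison of the first coordinates.
  have hexp (i : ZMod 4) : ∃ f : ℕ, ∀ x, affineMap Neg.neg c r ((i, 0) + x) =
      affineMap Neg.neg c r (i, 0) +
        affineMap Neg.neg c r ((affineMap Neg.neg c r)^[2 * f] x) := by
    obtain ⟨e, he⟩ := h i
    rcases Nat.even_or_odd' e with ⟨f, rfl | rfl⟩
    · exfalso
      have h1 := congrArg Prod.fst (he (1, 0))
      rw [Prod.fst_add, (affineMap_neg_iterate c r f (1, 0)).1] at h1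
      simp only [affineMap, Prod.mk_add_mk] at h1
      rw [neg_add] at h1
      exact absurd (add_left_cancel h1) (by decide)
    · refine ⟨f, fun x => ?_⟩
      rw [he, Function.iterate_succ_apply']
  have hadd (hf : ∀ i : ZMod 4, ∃ f : ℕ, (∀ x, affineMap Neg.neg c r ((i, 0) + x) =
      affineMap Neg.neg c r (i, 0) +
        affineMap Neg.neg c r ((affineMap Neg.neg c r)^[2 * f] x)) ∧
        ∀ x, (affineMap Neg.neg c r)^[2 * f] x = x) (i : ZMod 4) (x : ZMod 4 × ZMod p) :
      affineMap Neg.neg c r ((i, 0) + x) =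
        affineMap Neg.neg c r (i, 0) + affineMap Neg.neg c r x := by
    obtain ⟨f, h1, h2⟩ := hf i
    rw [h1, h2]
  by_cases hr2 : r ^ 2 = 1
  · rcases sq_eq_one_iff.1 hr2 with rfl | rfl
    · obtain ⟨f₁, hf₁⟩ := hexp 1
      obtain ⟨f₃, hf₃⟩ := hexp 3
      simp only [affineMap_neg_one_iterate] at hf₁ hf₃
      have h11 := congrArg Prod.snd (hf₁ (1, 0))
      have h12 := congrArg Prod.snd (hf₁ (2, 0))
      have h13 := congrArg Prod.snd (hf₁ (3, 0))
      have h31 := congrArg Prod.snd (hf₃ (1, 0))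
      have h32 := congrArg Prod.snd (hf₃ (2, 0))
      have h33 := congrArg Prod.snd (hf₃ (3, 0))
      simp only [affineMap, Prod.mk_add_mk, show (1 : ZMod 4) + 1 = 2 from rfl,
        show (1 : ZMod 4) + 2 = 3 from rfl, show (1 : ZMod 4) + 3 = 0 from rfl,
        show (3 : ZMod 4) + 1 = 0 from rfl, show (3 : ZMod 4) + 2 = 1 from rfl,
        show (3 : ZMod 4) + 3 = 2 from rfl, show -(1 : ZMod 4) = 3 from rfl,
        show -(2 : ZMod 4) = 2 from rfl, show -(3 : ZMod 4) = 1 from rfl, hc, add_zero,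
        mul_zero, one_mul] at h11 h12 h13 h31 h32 h33
      by_cases hs : c 1 + c 3 = 0
      · left
        have h1 : c 1 = 0 := by
          apply mul_left_cancel₀ h20
          apply mul_left_cancel₀ h20
          linear_combination h33 - h11 + 2 * hs + (f₃ - f₁ : ZMod p) * hs
        have h3 : c 3 = 0 := by linear_combination hs - h1
        have h2 : c 2 = 0 := by rw [h11, h1, h3]; ring
        have hall : ∀ i, c i = 0 := by
          intro i
          fin_cases i
          exacts [hc, h1, h2, h3]
        intro i x
        simp [affineMap, hall, add_comm]
      · right
        have hf1 : (f₁ : ZMod p) = -1 := by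
          apply mul_left_cancel₀ hs
          linear_combination -h13
        have hf3 : (f₃ : ZMod p) = -1 := by
          apply mul_left_cancel₀ hs
          linear_combination -h31
        rw [hf1] at h11
        rw [hf3] at h33
        have h2 : c 2 = 0 := by
          apply mul_left_cancel₀ h20
          linear_combination h11 + h33
        have h31' : c 3 = c 1 := by linear_combination h11 - h2
        refine ⟨rfl, ?_, h2, h31'⟩
        intro h1
        rw [h31', h1] at hs
        exact hs (add_zero 0)
    · left
      obtain ⟨f₁, hf₁⟩ := hexp 1
      obtain ⟨f₃, hf₃⟩ := hexp 3
      simp only [affineMap_neg_neg_one_iterate] at hf₁ hf₃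
      have h12 := congrArg Prod.snd (hf₁ (2, 0))
      have h32 := congrArg Prod.snd (hf₃ (2, 0))
      simp only [affineMap, Prod.mk_add_mk, show (1 : ZMod 4) + 2 = 3 from rfl,
        show (3 : ZMod 4) + 2 = 1 from rfl, show -(2 : ZMod 4) = 2 from rfl, add_zero,
        mul_zero, sub_self] at h12 h32
      have h2 : c 2 = 0 := by
        apply mul_left_cancel₀ h20
        linear_combination -h12 - h32
      have h3 : c 3 = c 1 := by linear_combination h12 + h2
      have hall : ∀ i, c (-i) - c i = 0 := by
        intro i
        fin_cases i
        · exact sub_self _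
        · exact sub_eq_zero.2 h3
        · exact sub_self _
        · exact sub_eq_zero.2 h3.symm
      refine hadd fun i => ?_
      obtain ⟨f, hf⟩ := hexp i
      refine ⟨f, hf, fun x => ?_⟩
      rw [affineMap_neg_neg_one_iterate, hall]
      simp
  · left
    have hr' : r ^ 2 - 1 ≠ 0 := sub_ne_zero.2 hr2
    refine hadd fun i => ?_
    obtain ⟨f, hf⟩ := hexp i
    refine ⟨f, hf, ?_⟩
    have hrf : r ^ (2 * f) = 1 := by
      have h1 := congrArg Prod.snd (hf (0, 1))
      obtain ⟨h2, h3⟩ := affineMap_neg_iterate c r f (0, 1)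
      simp only [affineMap, Prod.mk_add_mk, add_zero, zero_add, mul_zero, mul_one, hc,
        neg_zero] at h1 h2 h3
      rw [h2, hc, zero_add] at h1
      have h4 := mul_left_cancel₀ hr0 ((mul_one r).trans (add_left_cancel h1))
      rw [← h4] at h3
      apply mul_left_cancel₀ hr'
      linear_combination -h3
    intro x
    obtain ⟨h1, h2⟩ := affineMap_neg_iterate c r f x
    ext
    · exact h1
    · apply mul_left_cancel₀ hr'
      rw [h2, hrf]
      ring

/-- The map of `ZMod 4` fixing `0` with the given values at `1`, `2`, `3`. -/
def valueTable (a b c : ZMod 4) : ZMod 4 → ZMod 4 := ![0, a, b, c]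

/-- Exponents below `24` suffice, since `24` is the order of the symmetric group on `ZMod 4`. -/
theorem valueTable_skew : ∀ a b c : ZMod 4, (valueTable a b c).Injective →
    (∀ i : ZMod 4, ∃ e < 24, ∀ j : ZMod 4, valueTable a b c (i + j) =
      valueTable a b c i + (valueTable a b c)^[e] j) →
    a = 1 ∧ b = 2 ∧ c = 3 ∨ a = 3 ∧ b = 2 ∧ c = 1 := by
  decide +kernel

/-- The skew morphisms of `ZMod 4` are its automorphisms. -/
theorem eq_id_or_eq_neg_of_skew (g : Equiv.Perm (ZMod 4)) (h0 : g 0 = 0)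
    (h : ∀ i, ∃ e : ℕ, ∀ j, g (i + j) = g i + (g ^ e) j) : ⇑g = id ∨ ⇑g = Neg.neg := by
  have hg : ⇑g = valueTable (g 1) (g 2) (g 3) := by
    ext i
    fin_cases i
    exacts [h0, rfl, rfl, rfl]
  have h24 : g ^ 24 = 1 := by
    have hcard : Fintype.card (Equiv.Perm (ZMod 4)) = 24 := by
      rw [Fintype.card_perm, ZMod.card]
      rfl
    rw [← hcard, pow_card_eq_one]
  have hskew (i : ZMod 4) : ∃ e < 24, ∀ j, g (i + j) = g i + (⇑g)^[e] j := by
    obtain ⟨e, he⟩ := h i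
    refine ⟨e % 24, Nat.mod_lt _ (by norm_num), fun j => ?_⟩
    rw [Equiv.Perm.iterate_eq_pow, ← pow_eq_pow_mod e h24, he]
  rcases valueTable_skew (g 1) (g 2) (g 3) (hg ▸ g.injective) (by rwa [hg] at hskew) with
    ⟨h1, h2, h3⟩ | ⟨h1, h2, h3⟩
  · left
    ext i
    fin_cases i
    exacts [h0, h1, h2, h3]
  · right
    ext i
    fin_cases i
    exacts [h0, h1, h2, h3]

/-- The map `(i, y) ↦ (a i + d y, s y)` of `ZMod 4 × ZMod 3`, where `d` and `s` vanish at `0`. -/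
def tableMap (a d₁ d₂ : ZMod 4) (s₁ s₂ : ZMod 3) (x : ZMod 4 × ZMod 3) : ZMod 4 × ZMod 3 :=
  (a * x.1 + ![0, d₁, d₂] x.2, ![0, s₁, s₂] x.2)

/-- In a cyclic group of order `12` the order of a skew morphism is less than `12`, so exponents
below `12` suffice. -/
theorem tableMap_skew : ∀ (a d₁ d₂ : ZMod 4) (s₁ s₂ : ZMod 3), a ≠ 0 → a ≠ 2 → s₁ ≠ 0 →
    s₂ ≠ 0 → s₁ ≠ s₂ →
    (∀ y : ZMod 3, ∃ e < 12, ∀ x : ZMod 4 × ZMod 3, tableMap a d₁ d₂ s₁ s₂ ((0, y) + x) =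
      tableMap a d₁ d₂ s₁ s₂ (0, y) + (tableMap a d₁ d₂ s₁ s₂)^[e] x) →
    ∀ y : ZMod 3, ∀ x : ZMod 4 × ZMod 3, tableMap a d₁ d₂ s₁ s₂ ((0, y) + x) =
      tableMap a d₁ d₂ s₁ s₂ (0, y) + tableMap a d₁ d₂ s₁ s₂ x := by
  decide +kernel

/-! ### Transport to additive notation -/

/-- The additive form of `IsSkewMorphism`. -/
structure IsAddSkewMorphism {A : Type*} [AddGroup A] (φ : Equiv.Perm A) : Prop where
  map_zero : φ 0 = 0
  exists_exponent : ∀ a : A, ∃ i : ℕ, 0 < i ∧ ∀ b : A, φ (a + b) = φ a + (φ ^ i) b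

section Transport

variable {A B : Type*} [AddGroup A] [Group B] (e : Additive B ≃+ A)

/-- Conjugation of permutations by an isomorphism from a multiplicative to an additive group. -/
def transportPerm : Equiv.Perm B ≃* Equiv.Perm A :=
  (Additive.ofMul.trans e.toEquiv).permCongrHom

theorem transportPerm_apply (φ : Equiv.Perm B) (b : B) :
    transportPerm e φ (e (Additive.ofMul b)) = e (Additive.ofMul (φ b)) := by
  simp [transportPerm, Equiv.permCongrHom, Equiv.permCongr_apply]

theorem transport_forall {P : A → Prop} : (∀ a, P a) ↔ ∀ b : B, P (e (Additive.ofMul b)) :=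
  ((Additive.ofMul.trans e.toEquiv).forall_congr_right (q := P)).symm

theorem transport_mul (a b : B) : e (Additive.ofMul (a * b)) =
    e (Additive.ofMul a) + e (Additive.ofMul b) := map_add e _ _

theorem transport_inj {a b : B} : e (Additive.ofMul a) = e (Additive.ofMul b) ↔ a = b :=
  (Additive.ofMul.trans e.toEquiv).apply_eq_iff_eq

theorem isAddSkewMorphism_transportPerm {φ : Equiv.Perm B} :
    IsAddSkewMorphism (transportPerm e φ) ↔ IsSkewMorphism φ := by
  have h0 : transportPerm e φ 0 = 0 ↔ φ 1 = 1 := by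
    have h : (0 : A) = e (Additive.ofMul 1) := (map_zero e).symm
    rw [h, transportPerm_apply, transport_inj]
  have h1 : (∀ a : A, ∃ i : ℕ, 0 < i ∧ ∀ b : A, transportPerm e φ (a + b) =
      transportPerm e φ a + (transportPerm e φ ^ i) b) ↔
      ∀ a : B, ∃ i : ℕ, 0 < i ∧ ∀ b : B, φ (a * b) = φ a * (φ ^ i) b := by
    simp only [transport_forall e, ← map_pow, transportPerm_apply, ← transport_mul,
      transport_inj]
  exact ⟨fun h => ⟨h0.1 h.map_zero, h1.1 h.exists_exponent⟩,
    fun h => ⟨h0.2 h.map_one, h1.2 h.exists_exponent⟩⟩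

theorem isProperSkewMorphism_iff_transportPerm {φ : Equiv.Perm B} :
    IsProperSkewMorphism φ ↔ IsAddSkewMorphism (transportPerm e φ) ∧
      ¬ ∀ a b, transportPerm e φ (a + b) = transportPerm e φ a + transportPerm e φ b := by
  rw [isAddSkewMorphism_transportPerm, IsProperSkewMorphism]
  simp only [transport_forall e, transportPerm_apply, ← transport_mul, transport_inj]
  refine and_congr_right fun _ => not_congr ⟨?_, fun h => ?_⟩
  · rintro ⟨α, h⟩ a b
    simp [h]
  · exact ⟨{ φ with map_mul' := h }, fun b => rfl⟩

theorem skewEquivalent_iff_transportPerm {φ ψ : Equiv.Perm B} :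
    SkewEquivalent φ ψ ↔ ∃ α : A ≃+ A, ∀ a,
      transportPerm e ψ (α a) = α (transportPerm e φ a) := by
  constructor
  · rintro ⟨α, rfl⟩
    refine ⟨(e.symm.trans (MulEquiv.toAdditive α)).trans e, ?_⟩
    rw [transport_forall e]
    intro b
    have hα (b : B) : ((e.symm.trans (MulEquiv.toAdditive α)).trans e) (e (Additive.ofMul b)) =
        e (Additive.ofMul (α b)) := by simp
    rw [hα, transportPerm_apply, transportPerm_apply, hα]
    exact congrArg (fun b => e (Additive.ofMul (α (φ b)))) (α.symm_apply_apply b)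
  · rintro ⟨α, h⟩
    let β : MulAut B := MulEquiv.toAdditive.symm ((e.trans α).trans e.symm)
    refine ⟨β, ?_⟩
    rw [eq_mul_inv_iff_mul_eq]
    ext b
    rw [transport_forall e] at h
    have hβ (b : B) : e (Additive.ofMul (β b)) = α (e (Additive.ofMul b)) := by
      simp [β, MulEquiv.toAdditive]
    rw [← transport_inj e]
    change e (Additive.ofMul (ψ (β b))) = e (Additive.ofMul (β (φ b)))
    rw [← transportPerm_apply, hβ, hβ, h, transportPerm_apply]

/-- A skew morphism for which the map `b ↦ -φ a + φ (a + b)` does not change when `a` is replaced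
by `φ a` is coset-preserving: this map is the power of `φ` prescribed by the exponent at `a`. -/
theorem isCosetPreserving_of_transportPerm {φ : Equiv.Perm B} (h : IsSkewMorphism φ)
    (hF : ∀ a b, -transportPerm e φ a + transportPerm e φ (a + b) =
      -transportPerm e φ (transportPerm e φ a) +
        transportPerm e φ (transportPerm e φ a + b)) : IsCosetPreserving φ := by
  refine ⟨h, fun a => ?_⟩
  have hφ (b : B) : (φ a)⁻¹ * φ (a * b) = (φ (φ a))⁻¹ * φ (φ a * b) := by
    have h1 := hF (e (Additive.ofMul a)) (e (Additive.ofMul b))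
    simp only [transportPerm_apply, ← transport_mul, ← map_neg, ← ofMul_inv,
      transport_inj] at h1
    exact h1
  unfold skewPower
  simp only [← inv_mul_eq_iff_eq_mul, hφ]

end Transport

/-! ### Skew morphisms of `ZMod 4 × ZMod p` -/

section Classification

variable {p : ℕ} [Fact p.Prime]

/-- A permutation of `ZMod 4 × ZMod p` that is additive with respect to the elements of `ZMod p`
is an affine map. -/
theorem exists_eq_affineMap (hodd : Odd p) {φ : Equiv.Perm (ZMod 4 × ZMod p)}
    (h : IsAddSkewMorphism φ) (hP : ∀ y x, φ ((0, y) + x) = φ (0, y) + φ x) :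
    ∃ g c r, c 0 = 0 ∧ r ≠ 0 ∧ (g = id ∨ g = Neg.neg) ∧ ⇑φ = affineMap g c r := by
  let F : ZMod p →+ ZMod 4 × ZMod p := AddMonoidHom.mk' (fun y => φ (0, y)) fun y z => by
    rw [← hP, Prod.mk_add_mk, add_zero]
  have hF (y : ZMod p) : φ (0, y) = (0, (φ (0, 1)).2 * y) := by
    have h1 : F y = y.val • F 1 := by
      rw [← map_nsmul, nsmul_eq_mul, ZMod.natCast_zmod_val, mul_one]
    have h2 : p • F 1 = 0 := by
      rw [← map_nsmul, nsmul_eq_mul, CharP.cast_eq_zero, zero_mul, map_zero]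
    have h3 : (F 1).1 = 0 := by
      have h4 : (p : ZMod 4) * (F 1).1 = 0 := by
        simpa using congrArg Prod.fst h2
      have hcop : IsUnit (p : ZMod 4) := by
        rw [ZMod.isUnit_iff_coprime]
        exact (Nat.Coprime.pow_right 2 (Nat.coprime_two_right.2 hodd) : Nat.Coprime p (2 ^ 2))
      exact hcop.mul_right_eq_zero.1 h4
    change F y = (0, (F 1).2 * y)
    rw [h1]
    ext
    · simp [h3]
    · simp [mul_comm]
  have hr : (φ (0, 1)).2 ≠ 0 := by
    intro h0
    have h1 := hF 1
    rw [h0, zero_mul, ← Prod.zero_eq_mk, ← h.map_zero] at h1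
    exact one_ne_zero (congrArg Prod.snd (φ.injective h1))
  have hφ : ⇑φ = affineMap (fun i => (φ (i, 0)).1) (fun i => (φ (i, 0)).2) (φ (0, 1)).2 := by
    ext ⟨i, y⟩ : 1
    have h1 : ((i, y) : ZMod 4 × ZMod p) = (0, y) + (i, 0) := by simp
    rw [h1, hP, hF]
    simp [affineMap, Prod.ext_iff, add_comm]
  have hsurj : Function.Surjective fun i => (φ (i, 0)).1 := by
    intro i
    obtain ⟨x, hx⟩ := φ.surjective (i, 0)
    rw [hφ] at hx
    exact ⟨x.1, congrArg Prod.fst hx⟩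
  let g : Equiv.Perm (ZMod 4) := Equiv.ofBijective _ (Finite.surjective_iff_bijective.1 hsurj)
  have hg (x : ZMod 4 × ZMod p) : (φ x).1 = g x.1 := by
    rw [hφ]
    rfl
  have hgn (n : ℕ) (x : ZMod 4 × ZMod p) : ((φ ^ n) x).1 = (g ^ n) x.1 := by
    induction n with
    | zero => rfl
    | succ n ih => rw [pow_succ', Equiv.Perm.mul_apply, hg, ih, pow_succ', Equiv.Perm.mul_apply]
  refine ⟨g, _, _, ?_, hr, eq_id_or_eq_neg_of_skew g ?_ fun i => ?_, hφ⟩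
  · exact congrArg Prod.snd h.map_zero
  · exact congrArg Prod.fst h.map_zero
  · obtain ⟨n, -, hn⟩ := h.exists_exponent (i, 0)
    refine ⟨n, fun j => ?_⟩
    have h1 := congrArg Prod.fst (hn (j, 0))
    rwa [Prod.fst_add, hg, hg, hgn] at h1

/-- For `p = 3`, a skew morphism of `ZMod 4 × ZMod p` that is additive with respect to the
elements of `ZMod 4` is additive with respect to those of `ZMod p`. The hypothesis makes it one
of finitely many maps, which `tableMap_skew` checks. -/
theorem add_right_of_add_left {φ : Equiv.Perm (ZMod 4 × ZMod 3)}
    (h : IsAddSkewMorphism φ) (hord : orderOf φ ≤ 12)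
    (hQ : ∀ i x, φ ((i, 0) + x) = φ (i, 0) + φ x) (y : ZMod 3) (x : ZMod 4 × ZMod 3) :
    φ ((0, y) + x) = φ (0, y) + φ x := by
  let F : ZMod 4 →+ ZMod 4 × ZMod 3 := AddMonoidHom.mk' (fun i => φ (i, 0)) fun i j => by
    rw [← hQ, Prod.mk_add_mk, add_zero]
  have hF (i : ZMod 4) : φ (i, 0) = ((φ (1, 0)).1 * i, 0) := by
    have h1 : F i = i.val • F 1 := by
      rw [← map_nsmul, nsmul_eq_mul, ZMod.natCast_zmod_val, mul_one]
    have h2 : 4 • F 1 = 0 := by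
      rw [← map_nsmul]
      exact map_zero F
    have h3 : (F 1).2 = 0 := by
      have h4 : 4 • (F 1).2 = 0 := congrArg Prod.snd h2
      generalize (F 1).2 = z at h4
      revert z
      decide
    change F i = ((F 1).1 * i, 0)
    rw [h1]
    ext
    · simp [mul_comm]
    · simp [h3]
  have hφ : ⇑φ = tableMap (φ (1, 0)).1 (φ (0, 1)).1 (φ (0, 2)).1 (φ (0, 1)).2 (φ (0, 2)).2 := by
    ext ⟨i, y⟩ : 1
    have h1 : ((i, y) : ZMod 4 × ZMod 3) = (i, 0) + (0, y) := by simp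
    rw [h1, hQ, hF]
    fin_cases y
    · exact (congrArg _ h.map_zero).trans (by
        simp only [tableMap, Prod.ext_iff]
        simp
        exact ⟨rfl, rfl⟩)
    · simp only [tableMap, Prod.ext_iff]
      simp
      exact ⟨rfl, rfl⟩
    · simp only [tableMap, Prod.ext_iff]
      simp
      exact ⟨rfl, rfl⟩
  have ha0 : (φ (1, 0)).1 ≠ 0 := by
    intro h0
    have h1 := hF 1
    rw [h0, zero_mul, ← Prod.zero_eq_mk, ← h.map_zero] at h1
    exact absurd (congrArg Prod.fst (φ.injective h1)) (by decide)
  have ha2 : (φ (1, 0)).1 ≠ 2 := by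
    intro h0
    have h1 := hF 2
    rw [h0, show (2 : ZMod 4) * 2 = 0 from rfl, ← Prod.zero_eq_mk, ← h.map_zero] at h1
    exact absurd (congrArg Prod.fst (φ.injective h1)) (by decide)
  have hsq : (φ (1, 0)).1 * (φ (1, 0)).1 = 1 := by
    generalize (φ (1, 0)).1 = a at ha0 ha2
    revert a
    decide
  have hsep {u v : ZMod 4 × ZMod 3} (huv : (φ u).2 = (φ v).2) : u.2 = v.2 := by
    have h1 : φ u = φ (((φ (1, 0)).1 * ((φ u).1 - (φ v).1), 0) + v) := by
      rw [hQ, hF, ← mul_assoc, hsq, one_mul]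
      ext <;> simp [huv]
    rw [φ.injective h1]
    simp
  have hzero : (φ (0, 0)).2 = 0 := congrArg Prod.snd h.map_zero
  rw [hφ]
  refine tableMap_skew _ _ _ _ _ ha0 ha2 (fun h1 => ?_) (fun h2 => ?_) (fun h12 => ?_)
    (fun y => ?_) y x
  · exact absurd (hsep (h1.trans hzero.symm)) (by decide)
  · exact absurd (hsep (h2.trans hzero.symm)) (by decide)
  · exact absurd (hsep h12) (by decide)
  · rw [← hφ]
    obtain ⟨n, -, hn⟩ := h.exists_exponent (0, y)
    refine ⟨n % orderOf φ, (Nat.mod_lt _ (orderOf_pos φ)).trans_le hord, fun x => ?_⟩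
    rw [hn, Equiv.Perm.iterate_eq_pow, pow_mod_orderOf]

end Classification

/-! ### The kernel in coordinates -/

section KernelTransport

variable {B : Type*} [CommGroup B] {φ : Equiv.Perm B} {p : ℕ}

theorem IsSkewMorphism.transportPerm_add {A : Type*} [AddGroup A] (e : Additive B ≃+ A)
    (h : IsSkewMorphism φ) {a : A} (ha : (e.symm a).toMul ∈ skewKernel φ h.map_one) (x : A) :
    transportPerm e φ (a + x) = transportPerm e φ a + transportPerm e φ x := by
  obtain ⟨b, rfl⟩ : ∃ b : B, e (Additive.ofMul b) = a := ⟨(e.symm a).toMul, by simp⟩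
  obtain ⟨c, rfl⟩ : ∃ c : B, e (Additive.ofMul c) = x := ⟨(e.symm x).toMul, by simp⟩
  rw [← transport_mul, transportPerm_apply, transportPerm_apply, transportPerm_apply,
    ← transport_mul, transport_inj]
  exact h.map_mul_of_mem (by simpa using ha) c

/-- In a cyclic group of order `4 p`, the elements killed by `p` lie in the kernel of every skew
morphism. -/
theorem IsSkewMorphism.transportPerm_add_right [Finite B] [IsCyclic B] (hp : p.Prime)
    (hodd : Odd p) (hB : Nat.card B = 4 * p) (e : Additive B ≃+ ZMod 4 × ZMod p)
    (h : IsSkewMorphism φ) (y : ZMod p) (x : ZMod 4 × ZMod p) :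
    transportPerm e φ ((0, y) + x) = transportPerm e φ (0, y) + transportPerm e φ x := by
  have hpow {d : ℕ} (hd : d ∣ Nat.card (skewKernel φ h.map_one)) {a : ZMod 4 × ZMod p}
      (ha : d • a = 0) : (e.symm a).toMul ∈ skewKernel φ h.map_one := by
    refine Subgroup.mem_of_pow_eq_one_of_dvd_card _ hd ?_
    rw [← toMul_nsmul, ← map_nsmul, ha, map_zero, toMul_zero]
  rcases h.dvd_card_skewKernel hp hodd hB with hdvd | ⟨rfl, hdvd⟩
  · exact h.transportPerm_add e (hpow hdvd (by simp)) x
  · have : Nontrivial B := Finite.one_lt_card_iff_nontrivial.1 (by omega)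
    refine add_right_of_add_left ((isAddSkewMorphism_transportPerm e).2 h) ?_ (fun i x => ?_) y x
    · rw [MulEquiv.orderOf_eq]
      exact (hB ▸ h.orderOf_lt_card).le
    · refine h.transportPerm_add e (hpow hdvd ?_) x
      ext
      · change 4 • i = 0
        revert i
        decide
      · exact smul_zero (4 : ℕ)

end KernelTransport

/-! ### The proper skew morphisms of `ZMod 4 × ZMod p` -/

/-- The elements `l ≠ 1` of `ZMod p` with `l ^ 4 = 1`. -/
abbrev NontrivialFourthRoot (p : ℕ) : Type := {l : ZMod p // (1 + l) * (1 + l ^ 2) = 0}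

section Family

variable {p : ℕ}

/-- The permutation of `ZMod 4` underlying a standard skew morphism. -/
def baseMap : Option (NontrivialFourthRoot p) → Equiv.Perm (ZMod 4)
  | none => Equiv.neg (ZMod 4)
  | some _ => Equiv.refl (ZMod 4)

/-- The translation parts of a standard skew morphism: the crossed homomorphism
`i ↦ 1 + l + ⋯ + l ^ (i - 1)` for a fourth root of unity `l`, the parity for `none`. -/
def baseCocycle : Option (NontrivialFourthRoot p) → ZMod 4 → ZMod p
  | none => ![0, 1, 0, 1]
  | some l => ![0, 1, 1 + l.1, 1 + l.1 + l.1 ^ 2]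

/-- The permutation `(i, y) ↦ (± i, u c i + y)` of `ZMod 4 × ZMod p`, with the sign and the
function `c` given by `o`. These are the proper skew morphisms. -/
def standardSkew (o : Option (NontrivialFourthRoot p)) (u : (ZMod p)ˣ) :
    Equiv.Perm (ZMod 4 × ZMod p) :=
  Equiv.prodShear (baseMap o) fun i => Equiv.addLeft ((u : ZMod p) * baseCocycle o i)

theorem standardSkew_apply (o : Option (NontrivialFourthRoot p)) (u : (ZMod p)ˣ)
    (x : ZMod 4 × ZMod p) :
    standardSkew o u x = (baseMap o x.1, (u : ZMod p) * baseCocycle o x.1 + x.2) := rfl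

theorem standardSkew_none (u : (ZMod p)ˣ) :
    ⇑(standardSkew none u) = affineMap Neg.neg (fun i => (u : ZMod p) * baseCocycle none i) 1 := by
  ext x : 1
  rw [standardSkew_apply, affineMap, one_mul]
  rfl

theorem standardSkew_some (l : NontrivialFourthRoot p) (u : (ZMod p)ˣ) :
    ⇑(standardSkew (some l) u) = affineMap id (fun i => (u : ZMod p) * baseCocycle (some l) i) 1 := by
  ext x : 1
  rw [standardSkew_apply, affineMap, one_mul]
  rfl

theorem baseCocycle_zero (o : Option (NontrivialFourthRoot p)) : baseCocycle o 0 = 0 := by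
  cases o <;> rfl

theorem baseCocycle_one (o : Option (NontrivialFourthRoot p)) : baseCocycle o 1 = 1 := by
  cases o <;> rfl

theorem baseCocycle_none_two : (baseCocycle none 2 : ZMod p) = 0 := rfl

theorem baseCocycle_none_three : (baseCocycle none 3 : ZMod p) = 1 := rfl

theorem baseCocycle_some_two (l : NontrivialFourthRoot p) :
    baseCocycle (some l) 2 = 1 + l.1 := rfl

theorem baseCocycle_some_three (l : NontrivialFourthRoot p) :
    baseCocycle (some l) 3 = 1 + l.1 + l.1 ^ 2 := rfl

theorem ZMod.four_cases (i : ZMod 4) : i = 0 ∨ i = 1 ∨ i = 2 ∨ i = 3 := by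
  revert i
  decide

theorem baseCocycle_none_neg (i : ZMod 4) :
    (baseCocycle none (-i) : ZMod p) = baseCocycle none i := by
  rcases ZMod.four_cases i with rfl | rfl | rfl | rfl <;> rfl

theorem baseCocycle_none_add (i j : ZMod 4) : (baseCocycle none (i + j) : ZMod p) =
    baseCocycle none i + (1 - 2 * baseCocycle none i) * baseCocycle none j := by
  have h21 : (2 : ZMod 4) + 1 = 3 := rfl
  have h11 : (1 : ZMod 4) + 1 = 2 := rfl
  have h12 : (1 : ZMod 4) + 2 = 3 := rfl
  have h13 : (1 : ZMod 4) + 3 = 0 := rfl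
  have h22 : (2 : ZMod 4) + 2 = 0 := rfl
  have h23 : (2 : ZMod 4) + 3 = 1 := rfl
  have h31 : (3 : ZMod 4) + 1 = 0 := rfl
  have h32 : (3 : ZMod 4) + 2 = 1 := rfl
  have h33 : (3 : ZMod 4) + 3 = 2 := rfl
  rcases ZMod.four_cases i with rfl | rfl | rfl | rfl <;>
  rcases ZMod.four_cases j with rfl | rfl | rfl | rfl <;>
  simp only [h11, h12, h13, h21, h22, h23, h31, h32, h33, zero_add, add_zero, baseCocycle_zero,
    baseCocycle_one, baseCocycle_none_two, baseCocycle_none_three] <;> ring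

theorem baseCocycle_some_add (l : NontrivialFourthRoot p) (i j : ZMod 4) :
    baseCocycle (some l) (i + j) =
      baseCocycle (some l) i + l.1 ^ i.val * baseCocycle (some l) j := by
  have hstep (j : ZMod 4) : baseCocycle (some l) (1 + j) = 1 + l.1 * baseCocycle (some l) j := by
    have hl := l.2
    rcases ZMod.four_cases j with rfl | rfl | rfl | rfl
    · rw [add_zero, baseCocycle_zero, baseCocycle_one]
      ring
    · rw [show (1 : ZMod 4) + 1 = 2 from rfl, baseCocycle_some_two, baseCocycle_one]
      ring
    · rw [show (1 : ZMod 4) + 2 = 3 from rfl, baseCocycle_some_two, baseCocycle_some_three]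
      ring
    · rw [show (1 : ZMod 4) + 3 = 0 from rfl, baseCocycle_zero, baseCocycle_some_three]
      linear_combination -hl
  have hnat (n : ℕ) : baseCocycle (some l) (n + j) =
      baseCocycle (some l) n + l.1 ^ n * baseCocycle (some l) j := by
    induction n with
    | zero => simp [baseCocycle_zero]
    | succ n ih =>
      rw [Nat.cast_succ, add_comm (n : ZMod 4) 1, add_assoc, hstep, hstep, ih]
      ring
  simpa using hnat i.val

theorem NontrivialFourthRoot.pow_four (l : NontrivialFourthRoot p) : l.1 ^ 4 = 1 := by
  linear_combination (l.1 - 1) * l.2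

variable [Fact p.Prime]

theorem isAddSkewMorphism_standardSkew (o : Option (NontrivialFourthRoot p)) (u : (ZMod p)ˣ) :
    IsAddSkewMorphism (standardSkew o u) where
  map_zero := by
    rw [standardSkew_apply]
    cases o <;> simp [baseCocycle_zero, baseMap]
  exists_exponent a := by
    cases o with
    | none =>
      -- At even first coordinates the exponent is `1`, at odd ones it is `2 p - 1`,
      -- and `φ ^ (2 p - 1) = φ⁻¹`.
      have hpar : (baseCocycle none a.1 : ZMod p) = 0 ∨ (baseCocycle none a.1 : ZMod p) = 1 := by
        rcases ZMod.four_cases a.1 with h | h | h | h <;> rw [h]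
        exacts [Or.inl rfl, Or.inr rfl, Or.inl rfl, Or.inr rfl]
      rcases hpar with h0 | h1
      · refine ⟨1, one_pos, fun b => ?_⟩
        rw [pow_one]
        simp only [standardSkew_apply]
        ext
        · simp [baseMap, add_comm]
        · simp only [Prod.fst_add, Prod.snd_add, baseCocycle_none_add, h0]
          ring
      · refine ⟨2 * (p - 1) + 1, Nat.succ_pos _, fun b => ?_⟩
        rw [← Equiv.Perm.iterate_eq_pow, Function.iterate_succ_apply', standardSkew_none,
          affineMap_neg_one_iterate, Nat.cast_sub (Fact.out : p.Prime).one_le]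
        ext
        · simp [affineMap, add_comm]
        · simp only [affineMap, Prod.fst_add, Prod.snd_add, baseCocycle_none_add, h1,
            baseCocycle_none_neg, CharP.cast_eq_zero]
          push_cast
          ring
    | some l =>
      have hl : l.1 ≠ 0 := by
        intro h0
        have := l.pow_four
        rw [h0] at this
        simp at this
      refine ⟨(l.1 ^ a.1.val).val, ?_, fun b => ?_⟩
      · rw [Nat.pos_iff_ne_zero, Ne, ZMod.val_eq_zero]
        exact pow_ne_zero _ hl
      · rw [← Equiv.Perm.iterate_eq_pow, standardSkew_some, affineMap_id_one_iterate,
          ZMod.natCast_zmod_val]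
        ext
        · simp [affineMap]
        · simp only [affineMap, Prod.fst_add, Prod.snd_add, baseCocycle_some_add]
          ring

theorem standardSkew_not_additive (hodd : Odd p) (o : Option (NontrivialFourthRoot p))
    (u : (ZMod p)ˣ) :
    ¬ ∀ a b, standardSkew o u (a + b) = standardSkew o u a + standardSkew o u b := by
  intro h
  have h2 := two_ne_zero_of_odd hodd
  have h1 := congrArg Prod.snd (h (1, 0) (1, 0))
  simp only [standardSkew_apply, Prod.mk_add_mk, show (1 : ZMod 4) + 1 = 2 from rfl, add_zero,
    baseCocycle_one, mul_one] at h1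
  have h3 := mul_left_cancel₀ u.ne_zero (h1.trans (mul_two _).symm)
  cases o with
  | none => exact h2 h3.symm
  | some l =>
    rw [baseCocycle_some_two] at h3
    have hl : l.1 = 1 := by linear_combination h3
    have := l.2
    rw [hl] at this
    refine mul_ne_zero h2 h2 ?_
    linear_combination this

theorem standardSkew_injective :
    Function.Injective fun x : Option (NontrivialFourthRoot p) × (ZMod p)ˣ =>
      standardSkew x.1 x.2 := by
  rintro ⟨o, u⟩ ⟨o', u'⟩ h
  simp only at h
  have h1 := DFunLike.congr_fun h (1, 0)
  have h2 := congrArg Prod.snd (DFunLike.congr_fun h (2, 0))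
  simp only [standardSkew_apply, add_zero, baseCocycle_one, mul_one, Prod.mk.injEq] at h1 h2
  obtain ⟨h0, h1⟩ := h1
  obtain rfl : u = u' := Units.ext h1
  have h3 := mul_left_cancel₀ u.ne_zero h2
  cases o <;> cases o'
  · rfl
  · exact absurd h0 (by simp only [baseMap]; decide)
  · exact absurd h0 (by simp only [baseMap]; decide)
  · rw [baseCocycle_some_two, baseCocycle_some_two] at h3
    rw [Subtype.ext (add_left_cancel h3)]

/-- An additive skew morphism that is additive with respect to the elements of `ZMod p` is an
automorphism or standard. -/
theorem exists_eq_standardSkew (hodd : Odd p) {φ : Equiv.Perm (ZMod 4 × ZMod p)}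
    (h : IsAddSkewMorphism φ) (hP : ∀ y x, φ ((0, y) + x) = φ (0, y) + φ x)
    (hφ : ¬ ∀ a b, φ (a + b) = φ a + φ b) : ∃ o u, φ = standardSkew o u := by
  obtain ⟨g, c, r, hc, hr, hg, hF⟩ := exists_eq_affineMap hodd h hP
  have hskew (i : ZMod 4) : ∃ e : ℕ, ∀ x, affineMap g c r ((i, 0) + x) =
      affineMap g c r (i, 0) + (affineMap g c r)^[e] x := by
    obtain ⟨e, -, he⟩ := h.exists_exponent (i, 0)
    refine ⟨e, fun x => ?_⟩
    rw [← hF, Equiv.Perm.iterate_eq_pow, he]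
  have hnot : ¬ ∀ i x, affineMap g c r ((i, 0) + x) =
      affineMap g c r (i, 0) + affineMap g c r x := by
    rw [← hF]
    refine fun hadd => hφ fun a b => ?_
    have ha : a = (0, a.2) + (a.1, 0) := by simp
    rw [ha, add_assoc, hP, hadd, hP, add_assoc]
  rcases hg with rfl | rfl
  · obtain ⟨rfl, h1, l, hl, h2, h3⟩ := (affineMap_id_skew hc hskew).resolve_left hnot
    refine ⟨some ⟨l, hl⟩, Units.mk0 _ h1, DFunLike.coe_injective ?_⟩
    rw [hF, standardSkew_some]
    congr 1
    ext i
    rcases ZMod.four_cases i with rfl | rfl | rfl | rfl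
    · simp [hc, baseCocycle_zero]
    · simp [baseCocycle_one]
    · simp [h2, baseCocycle_some_two]
    · simp [h3, baseCocycle_some_three]
  · obtain ⟨rfl, h1, h2, h3⟩ := (affineMap_neg_skew hodd hc hr hskew).resolve_left hnot
    refine ⟨none, Units.mk0 _ h1, DFunLike.coe_injective ?_⟩
    rw [hF, standardSkew_none]
    congr 1
    ext i
    rcases ZMod.four_cases i with rfl | rfl | rfl | rfl
    · simp [hc, baseCocycle_zero]
    · simp [baseCocycle_one]
    · simp [h2, baseCocycle_none_two]
    · simp [h3, baseCocycle_none_three]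

/-- The map `b ↦ -φ a + φ (a + b)` depends only on the first coordinate of `a` up to sign. -/
theorem standardSkew_translate (o : Option (NontrivialFourthRoot p)) (u : (ZMod p)ˣ)
    (a b : ZMod 4 × ZMod p) :
    -standardSkew o u a + standardSkew o u (a + b) =
      -standardSkew o u (standardSkew o u a) + standardSkew o u (standardSkew o u a + b) := by
  cases o with
  | none =>
    ext
    · simp [standardSkew_apply, baseMap]
    · simp only [standardSkew_apply, baseMap, Equiv.neg_apply, Prod.fst_add, Prod.snd_add,
        Prod.snd_neg, baseCocycle_none_add, baseCocycle_none_neg]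
      ring
  | some l =>
    ext
    · simp [standardSkew_apply, baseMap]
    · simp only [standardSkew_apply, baseMap, Equiv.refl_apply, Prod.fst_add, Prod.snd_add,
        Prod.snd_neg, baseCocycle_some_add]
      ring

/-! ### Equivalence of the standard skew morphisms -/

/-- The invariant of a standard skew morphism that determines its equivalence class: the square
of the fourth root of unity, if there is one. -/
def standardInvariant (o : Option (NontrivialFourthRoot p)) : Option (ZMod p) :=
  o.map fun l => l.1 ^ 2

theorem NontrivialFourthRoot.eq_neg_one_or (l : NontrivialFourthRoot p) :
    l.1 = -1 ∨ l.1 ^ 2 = -1 := by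
  rcases mul_eq_zero.1 l.2 with h | h
  · exact Or.inl (by linear_combination h)
  · exact Or.inr (by linear_combination h)

/-- Together with `nsmul_standardSkew_some`, this separates the standard skew morphisms over the
inversion of `ZMod 4` from those over the identity. -/
theorem nsmul_standardSkew_none (hodd : Odd p) (u : (ZMod p)ˣ) :
    p • (standardSkew none u (1, 0) - (1, 0)) ≠ 0 := by
  intro h
  have h1 := congrArg Prod.fst h
  have hcop : IsUnit (p : ZMod 4) := by
    rw [ZMod.isUnit_iff_coprime]
    exact (Nat.Coprime.pow_right 2 (Nat.coprime_two_right.2 hodd) : Nat.Coprime p (2 ^ 2))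
  rw [Prod.smul_fst, nsmul_eq_mul] at h1
  have h2 : (-1 : ZMod 4) - 1 = 0 := hcop.mul_right_eq_zero.1 h1
  exact absurd h2 (by decide)

theorem nsmul_standardSkew_some (l : NontrivialFourthRoot p) (u : (ZMod p)ˣ)
    (x : ZMod 4 × ZMod p) : p • (standardSkew (some l) u x - x) = 0 := by
  ext
  · simp [standardSkew_apply, baseMap]
  · simp

/-- The element `(2, 0)` is the only involution. -/
theorem addEquiv_involution (hodd : Odd p) (α : (ZMod 4 × ZMod p) ≃+ (ZMod 4 × ZMod p)) :
    α (2, 0) = (2, 0) := by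
  have h2 : 2 • α (2, 0) = 0 := by
    rw [← map_nsmul, ← map_zero α]
    congr 1
    ext
    · rfl
    · exact smul_zero (2 : ℕ)
  have h0 : α (2, 0) ≠ 0 := by
    rw [← map_zero α]
    exact α.injective.ne fun h =>
      absurd (show (2 : ZMod 4) = 0 from congrArg Prod.fst h) (by decide)
  have hsnd : (α (2, 0)).2 = 0 := by
    have h3 := congrArg Prod.snd h2
    rw [Prod.smul_snd, nsmul_eq_mul] at h3
    exact (mul_eq_zero.1 h3).resolve_left (by exact_mod_cast two_ne_zero_of_odd hodd)
  have hfst : (α (2, 0)).1 ≠ 0 := fun h => h0 (Prod.ext h hsnd)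
  refine Prod.ext ?_ hsnd
  have h3 : 2 • (α (2, 0)).1 = 0 := congrArg Prod.fst h2
  change _ = (2 : ZMod 4)
  generalize (α (2, 0)).1 = z at h3 hfst
  revert z
  decide

/-- The automorphism `(i, y) ↦ (s i, v y)`. -/
def scaleEquiv (s : ZMod 4 ≃+ ZMod 4) (v : (ZMod p)ˣ) :
    (ZMod 4 × ZMod p) ≃+ (ZMod 4 × ZMod p) :=
  s.prodCongr (DistribMulAction.toAddEquiv (ZMod p) v)

theorem scaleEquiv_apply (s : ZMod 4 ≃+ ZMod 4) (v : (ZMod p)ˣ) (x : ZMod 4 × ZMod p) :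
    scaleEquiv s v x = (s x.1, v * x.2) := rfl

/-- Standard skew morphisms are equivalent if and only if they have the same invariant.
An automorphism that inverts `ZMod 4` exchanges the two square roots of `-1`. -/
theorem standardSkew_equivalent_iff (hodd : Odd p) (o o' : Option (NontrivialFourthRoot p))
    (u u' : (ZMod p)ˣ) :
    (∃ α : (ZMod 4 × ZMod p) ≃+ (ZMod 4 × ZMod p),
      ∀ x, standardSkew o' u' (α x) = α (standardSkew o u x)) ↔
    standardInvariant o = standardInvariant o' := by
  have h20 := two_ne_zero_of_odd hodd
  -- Rescaling `ZMod p` identifies all values of the parameter `u`.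
  have hscale (o : Option (NontrivialFourthRoot p)) :
      ∃ α : (ZMod 4 × ZMod p) ≃+ (ZMod 4 × ZMod p),
        ∀ x, standardSkew o u' (α x) = α (standardSkew o u x) := by
    refine ⟨scaleEquiv (AddEquiv.refl _) (u' * u⁻¹), fun x => ?_⟩
    simp only [standardSkew_apply, scaleEquiv_apply, AddEquiv.refl_apply, Units.val_mul]
    ext
    · rfl
    · simp only
      linear_combination -(u' * baseCocycle o x.1) * u.inv_mul
  constructor
  · rintro ⟨α, hα⟩
    have hα' (x) : α (p • (standardSkew o u x - x)) =
        p • (standardSkew o' u' (α x) - α x) := by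
      rw [hα, map_nsmul, map_sub]
    cases o <;> cases o'
    · rfl
    · have h := hα' (1, 0)
      rw [nsmul_standardSkew_some, ← map_zero α] at h
      exact absurd (α.injective h) (nsmul_standardSkew_none hodd u)
    · have h := hα' (α.symm (1, 0))
      rw [nsmul_standardSkew_some, map_zero, α.apply_symm_apply] at h
      exact absurd h.symm (nsmul_standardSkew_none hodd u')
    · rename_i l l'
      have hfix (l : NontrivialFourthRoot p) (u : (ZMod p)ˣ) :
          standardSkew (some l) u (2, 0) = (2, 0) ↔ l.1 = -1 := by
        rw [standardSkew_apply, baseCocycle_some_two, Prod.ext_iff]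
        simp [baseMap, add_comm (1 : ZMod p), add_eq_zero_iff_eq_neg]
      have hiff : l.1 = -1 ↔ l'.1 = -1 := by
        have h := hα (2, 0)
        rw [addEquiv_involution hodd] at h
        rw [← hfix l u, ← hfix l' u', h]
        conv_rhs => rw [← addEquiv_involution hodd α]
        rw [α.injective.eq_iff, addEquiv_involution hodd]
      refine congrArg some (show l.1 ^ 2 = l'.1 ^ 2 from ?_)
      by_cases hl : l.1 = -1
      · rw [hl, hiff.1 hl]
      · rw [l.eq_neg_one_or.resolve_left hl, l'.eq_neg_one_or.resolve_left (mt hiff.2 hl)]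
  · intro h
    cases o <;> cases o'
    · exact hscale none
    · exact absurd h (by simp [standardInvariant])
    · exact absurd h (by simp [standardInvariant])
    · rename_i l l'
      have hsq : l.1 ^ 2 = l'.1 ^ 2 := Option.some_injective _ h
      rcases sq_eq_sq_iff_eq_or_eq_neg.1 hsq with heq | heq
      · rw [Subtype.ext heq]
        exact hscale _
      · have hl : l.1 ^ 2 = -1 := by
          refine l.eq_neg_one_or.resolve_left fun h1 => ?_
          have hl' := l'.2
          rw [show l'.1 = 1 by linear_combination heq - h1] at hl'
          exact mul_ne_zero h20 h20 (by linear_combination hl')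
        have hl0 : l'.1 ≠ 0 := by
          intro h0
          rw [hsq, h0] at hl
          simp at hl
        refine ⟨scaleEquiv (AddEquiv.neg _) (u' * u⁻¹ * Units.mk0 l'.1 hl0), fun x => ?_⟩
        simp only [standardSkew_apply, scaleEquiv_apply, Units.val_mul, Units.val_mk0]
        have hu := u.inv_mul
        have hll : l.1 = -l'.1 := heq
        rw [hll] at hl
        have key : baseCocycle (some l') (-x.1) = l'.1 * baseCocycle (some l) x.1 := by
          rcases ZMod.four_cases x.1 with h | h | h | h <;> rw [h]
          · rw [neg_zero, baseCocycle_zero, baseCocycle_zero, mul_zero]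
          · rw [show -(1 : ZMod 4) = 3 from rfl, baseCocycle_some_three, baseCocycle_one]
            linear_combination hl
          · rw [show -(2 : ZMod 4) = 2 from rfl, baseCocycle_some_two, baseCocycle_some_two, hll]
            linear_combination hl
          · rw [show -(3 : ZMod 4) = 1 from rfl, baseCocycle_some_three, baseCocycle_one, hll]
            linear_combination (1 - l'.1) * hl
        ext
        · rfl
        · have hneg : AddEquiv.neg (ZMod 4) x.1 = -x.1 := rfl
          simp only [hneg, key]
          linear_combination -(u' * l'.1 * baseCocycle (some l) x.1) * hu

end Family

/-! ### Counting -/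

section Counting

variable {p : ℕ} [Fact p.Prime]

theorem neg_one_ne_one_of_odd (hodd : Odd p) : (-1 : ZMod p) ≠ 1 := by
  intro h
  exact two_ne_zero_of_odd hodd (by linear_combination -h)

/-- The element `-1` as a nontrivial fourth root of unity. -/
def NontrivialFourthRoot.negOne (p : ℕ) : NontrivialFourthRoot p := ⟨-1, by ring⟩

theorem not_sq_eq_neg_one (hp3 : p ≡ 3 [MOD 4]) (l : ZMod p) : l ^ 2 ≠ -1 := fun h =>
  ZMod.exists_sq_eq_neg_one_iff.1 ⟨l, by rw [← sq, h]⟩ hp3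

theorem exists_sq_eq_neg_one (hp1 : p ≡ 1 [MOD 4]) : ∃ l : ZMod p, l ^ 2 = -1 := by
  obtain ⟨l, hl⟩ := (ZMod.exists_sq_eq_neg_one_iff (p := p)).2 (by
    unfold Nat.ModEq at hp1
    omega)
  exact ⟨l, by rw [sq, hl]⟩

theorem card_nontrivialFourthRoot_of_mod_one (hodd : Odd p) (hp1 : p ≡ 1 [MOD 4]) :
    Nat.card (NontrivialFourthRoot p) = 3 := by
  obtain ⟨i, hi⟩ := exists_sq_eq_neg_one hp1
  have h11 := neg_one_ne_one_of_odd hodd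
  have hset : {l : ZMod p | (1 + l) * (1 + l ^ 2) = 0} = {-1, i, -i} := by
    ext l
    simp only [Set.mem_ofPred_eq, Set.mem_insert_iff, Set.mem_singleton_iff, mul_eq_zero]
    refine or_congr ⟨fun h => by linear_combination h, fun h => by rw [h]; ring⟩ ?_
    rw [← sq_eq_sq_iff_eq_or_eq_neg, hi]
    exact ⟨fun h => by linear_combination h, fun h => by linear_combination h⟩
  have h1 : (-1 : ZMod p) ≠ i := by
    rintro rfl
    exact h11 (by linear_combination -hi)
  have h2 : (-1 : ZMod p) ≠ -i := by
    intro h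
    rw [← neg_inj.1 h] at hi
    exact h11 (by linear_combination -hi)
  have h3 : i ≠ -i := by
    intro h
    have h0 : i = 0 := by
      apply mul_left_cancel₀ (two_ne_zero_of_odd hodd)
      linear_combination h
    rw [h0] at hi
    exact one_ne_zero (α := ZMod p) (by linear_combination hi)
  change Nat.card {l : ZMod p | (1 + l) * (1 + l ^ 2) = 0} = 3
  rw [hset, Nat.card_coe_set_eq, Set.ncard_eq_three]
  exact ⟨-1, i, -i, h1, h2, h3, rfl⟩

theorem card_nontrivialFourthRoot_of_mod_three (hp3 : p ≡ 3 [MOD 4]) :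
    Nat.card (NontrivialFourthRoot p) = 1 := by
  have : Unique (NontrivialFourthRoot p) :=
    { default := .negOne p
      uniq := fun l => Subtype.ext (l.eq_neg_one_or.resolve_right (not_sq_eq_neg_one hp3 _)) }
  exact Nat.card_unique

theorem ncard_range_standardInvariant_of_mod_one (hodd : Odd p) (hp1 : p ≡ 1 [MOD 4]) :
    (Set.range (standardInvariant (p := p))).ncard = 3 := by
  obtain ⟨i, hi⟩ := exists_sq_eq_neg_one hp1
  have hrange : Set.range (standardInvariant (p := p)) = {none, some 1, some (-1)} := by
    ext x
    constructor
    · rintro ⟨_ | l, rfl⟩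
      · exact Or.inl rfl
      · rcases l.eq_neg_one_or with h | h
        · exact Or.inr (Or.inl (by simp [standardInvariant, h]))
        · exact Or.inr (Or.inr (by simp [standardInvariant, h]))
    · rintro (rfl | rfl | rfl)
      · exact ⟨none, rfl⟩
      · exact ⟨some (.negOne p), by simp [standardInvariant, NontrivialFourthRoot.negOne]⟩
      · exact ⟨some ⟨i, by rw [hi]; ring⟩, by simp [standardInvariant, hi]⟩
  rw [hrange, Set.ncard_eq_three]
  refine ⟨none, some 1, some (-1), by simp, by simp, fun h => ?_, rfl⟩
  exact neg_one_ne_one_of_odd hodd (Option.some_injective _ h).symm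

theorem ncard_range_standardInvariant_of_mod_three (hp3 : p ≡ 3 [MOD 4]) :
    (Set.range (standardInvariant (p := p))).ncard = 2 := by
  have hrange : Set.range (standardInvariant (p := p)) = {none, some 1} := by
    ext x
    constructor
    · rintro ⟨_ | l, rfl⟩
      · exact Or.inl rfl
      · have h := l.eq_neg_one_or.resolve_right (not_sq_eq_neg_one hp3 _)
        exact Or.inr (by simp [standardInvariant, h])
    · rintro (rfl | rfl)
      · exact ⟨none, rfl⟩
      · exact ⟨some (.negOne p), by simp [standardInvariant, NontrivialFourthRoot.negOne]⟩
  rw [hrange, Set.ncard_pair (by simp)]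

end Counting

section Cyclic

variable {B : Type*} [Group B] [IsCyclic B] {p : ℕ} [Fact p.Prime]

theorem nonempty_addEquiv_zmod_four_prod (hodd : Odd p) (hB : Nat.card B = 4 * p) :
    Nonempty (Additive B ≃+ ZMod 4 × ZMod p) := by
  have hcop : Nat.Coprime 4 p :=
    (Nat.Coprime.pow_left 2 (Nat.coprime_two_left.2 hodd) : Nat.Coprime (2 ^ 2) p)
  have hcard : Nat.card (Additive B) = 4 * p := hB
  have e₁ := zmodAddCyclicAddEquiv (inferInstance : IsAddCyclic (Additive B))
  rw [hcard] at e₁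
  exact ⟨e₁.symm.trans (ZMod.chineseRemainder hcop).toAddEquiv⟩

/-- The proper skew morphisms of a cyclic group of order `4 p` are the transports of the
standard ones. -/
theorem isProperSkewMorphism_iff_exists_standardSkew (hodd : Odd p) (hB : Nat.card B = 4 * p)
    (e : Additive B ≃+ ZMod 4 × ZMod p) {φ : Equiv.Perm B} :
    IsProperSkewMorphism φ ↔ ∃ o u, transportPerm e φ = standardSkew o u := by
  rw [isProperSkewMorphism_iff_transportPerm e]
  constructor
  · rintro ⟨h, hφ⟩
    let := IsCyclic.commGroup (α := B)
    have : Finite B := Nat.finite_of_card_ne_zero (by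
      have := (Fact.out : p.Prime).pos
      omega)
    refine exists_eq_standardSkew hodd h ?_ hφ
    exact IsSkewMorphism.transportPerm_add_right Fact.out hodd hB e
      ((isAddSkewMorphism_transportPerm e).1 h)
  · rintro ⟨o, u, h⟩
    rw [h]
    exact ⟨isAddSkewMorphism_standardSkew o u, standardSkew_not_additive hodd o u⟩

/-- The parametrization of the proper skew morphisms of a cyclic group of order `4 p`. -/
noncomputable def properSkewEquiv (hodd : Odd p) (hB : Nat.card B = 4 * p)
    (e : Additive B ≃+ ZMod 4 × ZMod p) :
    Option (NontrivialFourthRoot p) × (ZMod p)ˣ ≃ {φ : Equiv.Perm B // IsProperSkewMorphism φ} :=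
  Equiv.ofBijective
    (fun x => ⟨(transportPerm e).symm (standardSkew x.1 x.2),
      (isProperSkewMorphism_iff_exists_standardSkew hodd hB e).2 ⟨x.1, x.2, by simp⟩⟩)
    ⟨fun x y hxy => standardSkew_injective
        ((transportPerm e).symm.injective (congrArg Subtype.val hxy)),
      fun φ => by
        obtain ⟨o, u, h⟩ := (isProperSkewMorphism_iff_exists_standardSkew hodd hB e).1 φ.2
        exact ⟨(o, u), Subtype.ext (by simp [← h])⟩⟩

theorem transportPerm_properSkewEquiv (hodd : Odd p) (hB : Nat.card B = 4 * p)
    (e : Additive B ≃+ ZMod 4 × ZMod p) (x : Option (NontrivialFourthRoot p) × (ZMod p)ˣ) :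
    transportPerm e (properSkewEquiv hodd hB e x).1 = standardSkew x.1 x.2 :=
  (transportPerm e).apply_symm_apply _

theorem card_properSkewMorphism (hodd : Odd p) (hB : Nat.card B = 4 * p) :
    Nat.card {φ : Equiv.Perm B // IsProperSkewMorphism φ} =
      (Nat.card (NontrivialFourthRoot p) + 1) * (p - 1) := by
  obtain ⟨e⟩ := nonempty_addEquiv_zmod_four_prod hodd hB
  rw [← Nat.card_congr (properSkewEquiv hodd hB e), Nat.card_prod, Finite.card_option,
    Nat.card_eq_fintype_card (α := (ZMod p)ˣ), ZMod.card_units]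

theorem card_quotient_properSkewSetoid (hodd : Odd p) (hB : Nat.card B = 4 * p) :
    Nat.card (Quotient (properSkewSetoid B)) =
      (Set.range (standardInvariant (p := p))).ncard := by
  obtain ⟨e⟩ := nonempty_addEquiv_zmod_four_prod hodd hB
  let f : {φ : Equiv.Perm B // IsProperSkewMorphism φ} → Option (ZMod p) := fun φ =>
    standardInvariant ((properSkewEquiv hodd hB e).symm φ).1
  have hker : properSkewSetoid B = Setoid.ker f := by
    ext φ ψ
    obtain ⟨x, rfl⟩ := (properSkewEquiv hodd hB e).surjective φ
    obtain ⟨y, rfl⟩ := (properSkewEquiv hodd hB e).surjective ψ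
    change SkewEquivalent _ _ ↔ f _ = f _
    rw [skewEquivalent_iff_transportPerm e, transportPerm_properSkewEquiv,
      transportPerm_properSkewEquiv, standardSkew_equivalent_iff hodd]
    simp [f]
  have hrange : Set.range f = Set.range (standardInvariant (p := p)) := by
    change Set.range (standardInvariant ∘ (Prod.fst ∘ (properSkewEquiv hodd hB e).symm)) = _
    exact (Prod.fst_surjective.comp (Equiv.surjective _)).range_comp _
  rw [hker, Nat.card_congr (Setoid.quotientKerEquivRange f), Nat.card_coe_set_eq, hrange]

end Cyclic

theorem corollary6p4 {B : Type*} [Group B] [IsCyclic B] (p : ℕ) (hp : p.Prime) (hodd : Odd p)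
    (hB : Nat.card B = 4 * p) :
    (p ≡ 1 [MOD 4] →
      Nat.card {φ : Equiv.Perm B // IsProperSkewMorphism φ} = 4 * p - 4 ∧
      Nat.card (Quotient (properSkewSetoid B)) = 3) ∧
    (p ≡ 3 [MOD 4] →
      Nat.card {φ : Equiv.Perm B // IsProperSkewMorphism φ} = 2 * p - 2 ∧
      Nat.card (Quotient (properSkewSetoid B)) = 2) ∧
    (∀ φ : Equiv.Perm B, IsProperSkewMorphism φ → IsCosetPreserving φ) := by
  have : Fact p.Prime := ⟨hp⟩
  refine ⟨fun hp1 => ⟨?_, ?_⟩, fun hp3 => ⟨?_, ?_⟩, fun φ hφ => ?_⟩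
  · rw [card_properSkewMorphism hodd hB, card_nontrivialFourthRoot_of_mod_one hodd hp1]
    omega
  · rw [card_quotient_properSkewSetoid hodd hB,
      ncard_range_standardInvariant_of_mod_one hodd hp1]
  · rw [card_properSkewMorphism hodd hB, card_nontrivialFourthRoot_of_mod_three hp3]
    omega
  · rw [card_quotient_properSkewSetoid hodd hB, ncard_range_standardInvariant_of_mod_three hp3]
  · obtain ⟨e⟩ := nonempty_addEquiv_zmod_four_prod hodd hB
    obtain ⟨o, u, h⟩ := (isProperSkewMorphism_iff_exists_standardSkew hodd hB e).1 hφ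
    refine isCosetPreserving_of_transportPerm e hφ.1 fun a b => ?_
    rw [h]
    exact standardSkew_translate o u a b
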